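/- **Setting.** Let $T=\begin{pmatrix}1&1\\0&1\end{pmatrix}$ and $V=\begin{pmatrix}1&0\\1&1\end{pmatrix}$. Let $f\not\equiv 0$ be a weakly holomorphic modular function for $\mathrm{SL}(2,\mathbb Z)$ (holomorphic on the upper half plane $\mathbb H$, $\mathrm{SL}(2,\mathbb Z)$-invariant, meromorphic at the cusp) which is real and non-negative on the arc $\{e^{it}:\pi/3\le t\le 2\pi/3\}$. For a hyperbolic $A\in\mathrm{SL}(2,\mathbb Z)$ with attracting fixed point $\tilde w$ and repelling fixed point $w$, let $Q(x,y)=ax^2+bxy+cy^2$ be the primitive integral quadratic form with $Q(w,1)=Q(\tilde w,1)=0$ and $\mathrm{sgn}(a)=\mathrm{sgn}(w-\tilde w)$, let $D=b^2-4ac$, and put $$I_f(A)=\int_{\tau_0}^{A\tau_0}\frac{f(\tau)\sqrt D}{Q(\tau,1)}\,d\tau ,$$ which does not depend on $\tau_0\in\mathbb H$. Put $I_f(A)=0$ if $A$ is not hyperbolic. For real $x>0$ let $(A_n)_{n\ge 0}$ be the sequence of matrices of the path to $x$ in the Farey tree: $A_0=I$, and $A_{n+1}=A_nV$ if $x<A_n(1)$,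 $A_{n+1}=A_nT$ if $x\ge A_n(1)$, where $A_n$ acts by fractional linear transformations. Define $$\Lambda_f(x)=\limsup_{n\to\infty}\frac{\mathrm{Re}(I_f(A_n))}{n},$$ and extend $\Lambda_f$ to all of $\mathbb R$ by $\Lambda_f(-x)=\Lambda_f(x)$ and $\Lambda_f(0)=0$. **Theorem 1.2.** Let $x\in\mathbb R$ have an eventually periodic simple continued fraction expansion $$x=[a_1;a_2,\dots,a_r,\overline{b_1,\dots,b_\ell}]$$ with $r\ge 0$ and $\ell\ge 2$ even, where $a_1\in\mathbb Z$ (if $r\ge 1$) and $a_2,\dots,a_r,b_1,\dots,b_\ell$ are positive integers. Then $$\Lambda_f(x)=\frac{\mathrm{Re}\bigl(I_f(T^{b_1}V^{b_2}T^{b_3}\cdots T^{b_{\ell-1}}V^{b_\ell})\bigr)}{b_1+\dots+b_\ell}.$$ In particular, $\Lambda_f(x)>0$. -/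

import Mathlib

open scoped UpperHalfPlane MatrixGroups Manifold Topology

noncomputable section

namespace ModularLyapunov

/-! ### Weakly holomorphic modular functions -/

/-- A weakly holomorphic modular function for `SL(2, ℤ)`: a holomorphic function on the upper half
plane which is `SL(2, ℤ)`-invariant (weight `0`) and meromorphic at the cusp `∞`, i.e.
`q ^ N * f` is bounded as `Im τ → ∞` for some `N`, where `q = exp (2 π i τ)`. -/
structure IsWeaklyHolomorphicModularFunction (f : ℍ → ℂ) : Prop where
  holomorphic : MDifferentiable 𝓘(ℂ) 𝓘(ℂ) f
  invariant : ∀ (γ : SL(2, ℤ)) (τ : ℍ), f (γ • τ) = f τ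
  meromorphic_cusp : ∃ N : ℕ, UpperHalfPlane.IsBoundedAtImInfty
    (fun τ : ℍ => Complex.exp (2 * Real.pi * Complex.I * (τ : ℂ)) ^ N * f τ)

/-- `f` is real and non-negative on the geodesic arc `{e^{it} : π/3 ≤ t ≤ 2π/3}`. -/
def IsNonnegOnArc (f : ℍ → ℂ) : Prop :=
  ∀ t ∈ Set.Icc (Real.pi / 3) (2 * Real.pi / 3),
    (f (UpperHalfPlane.ofComplex (Complex.exp (t * Complex.I)))).im = 0 ∧
      0 ≤ (f (UpperHalfPlane.ofComplex (Complex.exp (t * Complex.I)))).re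

/-! ### The quadratic form of a hyperbolic matrix -/

/-- The greatest common divisor of the coefficients of the fixed point equation
`A₁₀ x² + (A₁₁ - A₀₀) x - A₀₁ = 0`. -/
def fixedPointGcd (A : SL(2, ℤ)) : ℤ :=
  Int.gcd (A 1 0) (Int.gcd (A 1 1 - A 0 0) (A 0 1))

/-- The coefficient `a` of the form `Q = a x² + b x y + c y²` attached to `A`. -/
def formA (A : SL(2, ℤ)) : ℤ :=
  -(A.1.trace.sign * (A 1 0 / fixedPointGcd A))

/-- The coefficient `b` of the form `Q = a x² + b x y + c y²` attached to `A`. -/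
def formB (A : SL(2, ℤ)) : ℤ :=
  -(A.1.trace.sign * ((A 1 1 - A 0 0) / fixedPointGcd A))

/-- The coefficient `c` of the form `Q = a x² + b x y + c y²` attached to `A`. -/
def formC (A : SL(2, ℤ)) : ℤ :=
  A.1.trace.sign * (A 0 1 / fixedPointGcd A)

/-- The discriminant `D = b² - 4ac` of the form attached to `A`. -/
def formD (A : SL(2, ℤ)) : ℤ :=
  formB A ^ 2 - 4 * formA A * formC A

/-- `x` is a real fixed point of `A`, acting by fractional linear transformations. -/
def IsRealFixedPoint (A : SL(2, ℤ)) (x : ℝ) : Prop :=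
  (A 1 0 : ℝ) * x + A 1 1 ≠ 0 ∧ ((A 0 0 : ℝ) * x + A 0 1) / ((A 1 0 : ℝ) * x + A 1 1) = x

/-- `x` is an attracting fixed point of `A`: the derivative `(A₁₀ x + A₁₁)⁻²` of the action is
less than `1` in absolute value. -/
def IsAttractingFixedPoint (A : SL(2, ℤ)) (x : ℝ) : Prop :=
  IsRealFixedPoint A x ∧ 1 / ((A 1 0 : ℝ) * x + A 1 1) ^ 2 < 1

/-- `x` is a repelling fixed point of `A`: the derivative `(A₁₀ x + A₁₁)⁻²` of the action is
greater than `1` in absolute value. -/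
def IsRepellingFixedPoint (A : SL(2, ℤ)) (x : ℝ) : Prop :=
  IsRealFixedPoint A x ∧ 1 < 1 / ((A 1 0 : ℝ) * x + A 1 1) ^ 2

/-- The form is a nonzero multiple of the fixed point equation of `A`. -/
theorem form_rel (A : SL(2, ℤ)) (hA : A.1.IsHyperbolic) :
    0 < fixedPointGcd A ∧ A.1.trace.sign * A.1.trace.sign = 1 ∧
      A 1 0 = -(A.1.trace.sign * fixedPointGcd A) * formA A ∧
      A 1 1 - A 0 0 = -(A.1.trace.sign * fixedPointGcd A) * formB A ∧
      -A 0 1 = -(A.1.trace.sign * fixedPointGcd A) * formC A ∧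
      A 1 0 ≠ 0 ∧ Int.gcd (formA A) (Int.gcd (formB A) (formC A)) = 1 := by
  have hdet : A 0 0 * A 1 1 - A 0 1 * A 1 0 = 1 := by
    have := A.2; rwa [Matrix.det_fin_two] at this
  have hdisc : 0 < (A 0 0 + A 1 1) ^ 2 - 4 := by
    have h := hA
    rw [Matrix.IsHyperbolic, Matrix.discr_fin_two, A.2, Matrix.trace_fin_two] at h
    simpa using h
  have htr : A.1.trace = A 0 0 + A 1 1 := Matrix.trace_fin_two A.1
  have hsq : A.1.trace.sign * A.1.trace.sign = 1 := by
    rw [htr]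
    rcases lt_trichotomy (A 0 0 + A 1 1) 0 with h | h | h
    · simp [Int.sign_eq_neg_one_of_neg h]
    · rw [h] at hdisc; norm_num at hdisc
    · simp [Int.sign_eq_one_of_pos h]
  have hr : A 1 0 ≠ 0 := by
    intro h
    rw [h] at hdet
    have h1 : A 0 0 * A 1 1 = 1 := by linarith
    rcases Int.eq_one_or_neg_one_of_mul_eq_one' h1 with ⟨h2, h3⟩ | ⟨h2, h3⟩ <;>
      rw [h2, h3] at hdisc <;> norm_num at hdisc
  have hg : 0 < Int.gcd (A 1 0) (Int.gcd (A 1 1 - A 0 0) (A 0 1)) := Int.gcd_pos_of_ne_zero_left _ hr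
  have hg' : 0 < fixedPointGcd A := by unfold fixedPointGcd; exact_mod_cast hg
  have d1 : fixedPointGcd A ∣ A 1 0 := Int.gcd_dvd_left ..
  have d0 : fixedPointGcd A ∣ (Int.gcd (A 1 1 - A 0 0) (A 0 1) : ℤ) := Int.gcd_dvd_right ..
  have d2 : fixedPointGcd A ∣ A 1 1 - A 0 0 := d0.trans (Int.gcd_dvd_left ..)
  have d3 : fixedPointGcd A ∣ A 0 1 := d0.trans (Int.gcd_dvd_right ..)
  obtain ⟨a, ha⟩ := d1
  obtain ⟨b, hb⟩ := d2
  obtain ⟨c, hc⟩ := d3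
  have ea : A 1 0 / fixedPointGcd A = a := by rw [ha, Int.mul_ediv_cancel_left _ hg'.ne']
  have eb : (A 1 1 - A 0 0) / fixedPointGcd A = b := by rw [hb, Int.mul_ediv_cancel_left _ hg'.ne']
  have ec : A 0 1 / fixedPointGcd A = c := by rw [hc, Int.mul_ediv_cancel_left _ hg'.ne']
  refine ⟨hg', hsq, ?_, ?_, ?_, hr, ?_⟩
  · rw [formA, ea]; linear_combination ha - fixedPointGcd A * a * hsq
  · rw [formB, eb]; linear_combination hb - fixedPointGcd A * b * hsq
  · rw [formC, ec]; linear_combination -hc + fixedPointGcd A * c * hsq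
  · have hgcd : Int.gcd a (Int.gcd b c) = 1 := by
      have h : (fixedPointGcd A).natAbs * 1 = (fixedPointGcd A).natAbs * Int.gcd a (Int.gcd b c) := by
        rw [← Int.gcd_mul_left]
        have : fixedPointGcd A * (Int.gcd b c : ℤ) = (Int.gcd (A 1 1 - A 0 0) (A 0 1) : ℤ) := by
          rw [hb, hc, Int.gcd_mul_left]
          push_cast
          rw [abs_of_pos hg']
        rw [this, ← ha]
        simp [fixedPointGcd]
      exact (Nat.eq_of_mul_eq_mul_left (Int.natAbs_pos.2 hg'.ne') h).symm
    rw [formA, formB, formC, ea, eb, ec]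
    rcases mul_self_eq_one_iff.1 hsq with h | h <;> rw [h] <;> simpa using hgcd

/-- For hyperbolic `A`, the form `Q = [a, b, c]` above is the primitive integral form vanishing at
the repelling fixed point `w` and at the attracting fixed point `w'` of `A`, normalized by
`sgn a = sgn (w - w')`. -/
theorem form_spec (A : SL(2, ℤ)) (hA : A.1.IsHyperbolic) :
    Int.gcd (formA A) (Int.gcd (formB A) (formC A)) = 1 ∧ 0 < formD A ∧
    ∃ w w' : ℝ, IsRepellingFixedPoint A w ∧ IsAttractingFixedPoint A w' ∧
      formA A * w ^ 2 + formB A * w + formC A = 0 ∧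
      formA A * w' ^ 2 + formB A * w' + formC A = 0 ∧
      SignType.sign (formA A : ℝ) = SignType.sign (w - w') := by
  obtain ⟨hg, hσ, ha, hb, hc, hr, hgcd⟩ := form_rel A hA
  have hdet : A 0 0 * A 1 1 - A 0 1 * A 1 0 = 1 := by
    have := A.2; rwa [Matrix.det_fin_two] at this
  have htr : A.1.trace = A 0 0 + A 1 1 := Matrix.trace_fin_two A.1
  have hdisc : 0 < (A 0 0 + A 1 1) ^ 2 - 4 := by
    have h := hA
    rw [Matrix.IsHyperbolic, Matrix.discr_fin_two, A.2, Matrix.trace_fin_two] at h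
    simpa using h
  have hpos : 0 ≤ A.1.trace.sign * (A 0 0 + A 1 1) := by
    rw [← htr, Int.sign_mul_self_eq_abs]; exact abs_nonneg _
  generalize A.1.trace.sign = σ at *
  generalize fixedPointGcd A = g at *
  have hD : g ^ 2 * formD A = (A 0 0 + A 1 1) ^ 2 - 4 := by
    rw [formD]
    have h1 : (A 1 1 - A 0 0) ^ 2 + 4 * A 0 1 * A 1 0 = (A 0 0 + A 1 1) ^ 2 - 4 := by
      linear_combination (-4) * hdet
    have h2 : (A 1 1 - A 0 0) ^ 2 + 4 * A 0 1 * A 1 0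
        = (σ * σ) * g ^ 2 * (formB A ^ 2 - 4 * formA A * formC A) := by
      rw [hb, ha, show A 0 1 = (σ * g) * formC A by linear_combination -hc]; ring
    rw [← h1, h2, hσ]; ring
  have hDpos : 0 < formD A := by
    rw [← hD] at hdisc
    exact pos_of_mul_pos_right hdisc (sq_nonneg _)
  have haz : formA A ≠ 0 := by rintro h; rw [h] at ha; simp at ha; exact hr ha
  refine ⟨hgcd, hDpos, ?_⟩
  have hd : 0 < Real.sqrt (formD A) := Real.sqrt_pos.2 (by exact_mod_cast hDpos)
  have hd2 : Real.sqrt (formD A) ^ 2 = formD A := Real.sq_sqrt (by exact_mod_cast hDpos.le)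
  have hDr : (formD A : ℝ) = (formB A : ℝ) ^ 2 - 4 * formA A * formC A := by
    rw [formD]; push_cast; ring
  have haR : (formA A : ℝ) ≠ 0 := by exact_mod_cast haz
  have hgR : (0 : ℝ) < g := by exact_mod_cast hg
  have hσR : (σ : ℝ) * σ = 1 := by exact_mod_cast hσ
  have ha' : (A 1 0 : ℝ) = -(σ * g) * formA A := by exact_mod_cast ha
  have hb' : (A 1 1 : ℝ) - A 0 0 = -(σ * g) * formB A := by exact_mod_cast hb
  have hc' : -(A 0 1 : ℝ) = -(σ * g) * formC A := by exact_mod_cast hc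
  have hD' : (g : ℝ) ^ 2 * formD A = (A 0 0 + A 1 1 : ℝ) ^ 2 - 4 := by exact_mod_cast hD
  have hpos' : (0 : ℝ) ≤ σ * (A 0 0 + A 1 1) := by exact_mod_cast hpos
  generalize Real.sqrt (formD A) = d at *
  -- the two roots
  have root : ∀ ε : ℝ, ε * ε = 1 →
      (formA A : ℝ) * ((-formB A + ε * d) / (2 * formA A)) ^ 2
        + formB A * ((-formB A + ε * d) / (2 * formA A)) + formC A = 0 := by
    intro ε hε
    field_simp
    linear_combination d ^ 2 * hε + hd2 + hDr
  have den : ∀ ε : ℝ, (A 1 0 : ℝ) * ((-formB A + ε * d) / (2 * formA A)) + A 1 1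
      = σ * ((σ * (A 0 0 + A 1 1) - ε * (g * d)) / 2) := by
    intro ε
    rw [ha']
    field_simp
    linear_combination hb' - (A 0 0 + A 1 1) * hσR
  have fixed : ∀ x : ℝ, (formA A : ℝ) * x ^ 2 + formB A * x + formC A = 0 →
      (A 1 0 : ℝ) * x + A 1 1 ≠ 0 → IsRealFixedPoint A x := by
    intro x hx h0
    refine ⟨h0, ?_⟩
    rw [div_eq_iff h0]
    linear_combination (σ * g) * hx - x ^ 2 * ha' - x * hb' - hc'
  have he : 0 < (g : ℝ) * d := mul_pos hgR hd
  have hu2 : (σ * (A 0 0 + A 1 1) : ℝ) ^ 2 = (g * d) ^ 2 + 4 := by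
    linear_combination (A 0 0 + A 1 1 : ℝ) ^ 2 * hσR - hD' - (g : ℝ) ^ 2 * hd2
  generalize (σ * (A 0 0 + A 1 1) : ℝ) = u at *
  generalize (g * d : ℝ) = e at *
  have hue : e < u := by nlinarith
  have hu : 2 < u := by nlinarith
  have hm0 : 0 < (u - 1 * e) / 2 := by linarith
  have hm1 : (u - 1 * e) / 2 < 1 := by nlinarith
  have hp1 : 1 < (u - (-1) * e) / 2 := by linarith
  have hσ0 : (σ : ℝ) ≠ 0 := by rintro h; rw [h] at hσR; simp at hσR
  refine ⟨(-formB A + 1 * d) / (2 * formA A), (-formB A + (-1) * d) / (2 * formA A),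
    ⟨fixed _ (root _ (by norm_num)) ?_, ?_⟩, ⟨fixed _ (root _ (by norm_num)) ?_, ?_⟩,
    root _ (by norm_num), root _ (by norm_num), ?_⟩
  · rw [den]; exact mul_ne_zero hσ0 hm0.ne'
  · rw [den, mul_pow, sq (σ : ℝ), hσR, one_mul, one_lt_div (by positivity)]
    nlinarith
  · rw [den]; exact mul_ne_zero hσ0 (by linarith)
  · rw [den, mul_pow, sq (σ : ℝ), hσR, one_mul, div_lt_one (by positivity)]
    nlinarith
  · have : (-formB A + 1 * d) / (2 * formA A) - (-formB A + (-1) * d) / (2 * formA A)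
        = d / formA A := by field_simp; ring
    rw [this]
    rcases lt_or_gt_of_ne haR with h | h
    · rw [sign_neg h, sign_neg (div_neg_of_pos_of_neg hd h)]
    · rw [sign_pos h, sign_pos (div_pos hd h)]

/-! ### Cycle integrals -/

/-- The integrand `f(τ) √D / Q(τ, 1)`. -/
def cycleIntegrand (f : ℍ → ℂ) (A : SL(2, ℤ)) (τ : ℂ) : ℂ :=
  f (UpperHalfPlane.ofComplex τ) * (Real.sqrt (formD A) : ℂ) /
    ((formA A : ℂ) * τ ^ 2 + (formB A : ℂ) * τ + (formC A : ℂ))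

open Classical in
/-- The integral of `f(τ) √D / Q(τ, 1) dτ` along the segment from `τ₀` to `A τ₀` in the upper half
plane if `A` is hyperbolic, and `0` otherwise. -/
def cycleIntegralFrom (f : ℍ → ℂ) (A : SL(2, ℤ)) (τ₀ : ℍ) : ℂ :=
  if A.1.IsHyperbolic then
    ∫ t in (0 : ℝ)..1,
      cycleIntegrand f A ((τ₀ : ℂ) + (t : ℂ) * (((A • τ₀ : ℍ) : ℂ) - (τ₀ : ℂ))) *
        (((A • τ₀ : ℍ) : ℂ) - (τ₀ : ℂ))
  else 0

/-- The cycle integral `I_f(A) = ∫_{τ₀}^{A τ₀} f(τ) √D / Q(τ, 1) dτ`, for the base point `τ₀ = i`;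
see `cycleIntegralFrom_eq` for the independence of `τ₀`. -/
def cycleIntegral (f : ℍ → ℂ) (A : SL(2, ℤ)) : ℂ :=
  cycleIntegralFrom f A UpperHalfPlane.I

/-- The cycle integral can be computed from any base point. -/
theorem cycleIntegralFrom_eq {f : ℍ → ℂ} (hf : IsWeaklyHolomorphicModularFunction f)
    (A : SL(2, ℤ)) (τ₀ : ℍ) : cycleIntegralFrom f A τ₀ = cycleIntegral f A := by
  unfold cycleIntegral cycleIntegralFrom
  split_ifs with hA
  swap
  · rfl
  obtain ⟨hg, hσ, ha, hb, hc, hr, -⟩ := form_rel A hA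
  obtain ⟨-, hD, -⟩ := form_spec A hA
  have hdet : A 0 0 * A 1 1 - A 0 1 * A 1 0 = 1 := by
    have := A.2; rwa [Matrix.det_fin_two] at this
  have hk : -(A.1.trace.sign * fixedPointGcd A) ≠ 0 := by
    refine neg_ne_zero.2 (mul_ne_zero ?_ hg.ne')
    rintro h; rw [h] at hσ; simp at hσ
  generalize -(A.1.trace.sign * fixedPointGcd A) = k at *
  set U : Set ℂ := {z | 0 < z.im} with hU
  have hUo : IsOpen U := isOpen_lt continuous_const Complex.continuous_im
  have hUc : Convex ℝ U := convex_halfSpace_im_gt 0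
  -- the denominators do not vanish
  have hden : ∀ z ∈ U, (A 1 0 : ℂ) * z + A 1 1 ≠ 0 := by
    intro z hz h
    have := congrArg Complex.im h
    simp only [Complex.add_im, Complex.mul_im, Complex.intCast_re, Complex.intCast_im, zero_mul,
      add_zero, Complex.zero_im, mul_eq_zero, Int.cast_eq_zero] at this
    rcases this with h | h
    · exact hr h
    · exact (ne_of_gt hz) h
  have hQ : ∀ z ∈ U, (formA A : ℂ) * z ^ 2 + (formB A : ℂ) * z + (formC A : ℂ) ≠ 0 := by
    intro z hz h
    have h1 := congrArg Complex.im h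
    have h2 := congrArg Complex.re h
    simp only [sq, Complex.add_im, Complex.mul_im, Complex.add_re, Complex.mul_re,
      Complex.intCast_re, Complex.intCast_im, zero_mul, add_zero, sub_zero, Complex.zero_im,
      Complex.zero_re] at h1 h2
    have hD' : (0 : ℝ) < (formB A : ℝ) ^ 2 - 4 * formA A * formC A := by
      have : (0 : ℝ) < (formD A : ℤ) := by exact_mod_cast hD
      rw [formD] at this; push_cast at this; exact this
    have hy : (0 : ℝ) < z.im := hz
    have h3 : 2 * (formA A : ℝ) * z.re + formB A = 0 := by
      have : z.im * (2 * (formA A : ℝ) * z.re + formB A) = 0 := by linear_combination h1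
      exact (mul_eq_zero.1 this).resolve_left hy.ne'
    have h4 : (formB A : ℝ) ^ 2 - 4 * formA A * formC A = -4 * ((formA A : ℝ) * z.im) ^ 2 := by
      linear_combination (2 * (formA A : ℝ) * z.re + formB A) * h3 - 4 * (formA A : ℝ) * h2
    nlinarith [sq_nonneg ((formA A : ℝ) * z.im)]
  -- a primitive
  have hfd : DifferentiableOn ℂ (cycleIntegrand f A) U := by
    unfold cycleIntegrand
    refine DifferentiableOn.div (DifferentiableOn.mul_const ?_ _) (by fun_prop) hQ
    exact UpperHalfPlane.mdifferentiable_iff.1 hf.holomorphic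
  obtain ⟨G, hG'⟩ := hUc.exists_forall_hasDerivWithinAt hfd
  have hG : ∀ z ∈ U, HasDerivAt G (cycleIntegrand f A z) z :=
    fun z hz => (hG' z hz).hasDerivAt (hUo.mem_nhds hz)
  have hint : ∀ z ∈ U, ∀ w ∈ U,
      ∫ t in (0 : ℝ)..1, cycleIntegrand f A (z + (t : ℂ) * (w - z)) * (w - z) = G w - G z := by
    intro z hz w hw
    have hmem : ∀ t ∈ Set.uIcc (0 : ℝ) 1, z + (t : ℂ) * (w - z) ∈ U := by
      intro t ht
      rw [Set.uIcc_of_le zero_le_one] at ht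
      have := hUc.add_smul_sub_mem hz hw ht
      simpa using this
    have h := intervalIntegral.integral_eq_sub_of_hasDerivAt (a := (0 : ℝ)) (b := 1)
      (f := fun t : ℝ => G (z + (t : ℂ) * (w - z)))
      (f' := fun t : ℝ => cycleIntegrand f A (z + (t : ℂ) * (w - z)) * (w - z)) ?_ ?_
    · rw [h]; simp
    · intro t ht
      have h1 : HasDerivAt (fun t : ℝ => z + (t : ℂ) * (w - z)) (w - z) t := by
        simpa using ((Complex.ofRealCLM.hasDerivAt (x := t)).mul_const (w - z)).const_add z
      exact (hG _ (hmem t ht)).comp t h1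
    · apply ContinuousOn.intervalIntegrable
      refine ContinuousOn.mul ?_ continuousOn_const
      exact hfd.continuousOn.comp (by fun_prop) hmem
  -- the action of `A`
  let m : ℂ → ℂ := fun z => ((A 0 0 : ℂ) * z + A 0 1) / ((A 1 0 : ℂ) * z + A 1 1)
  have hm : ∀ τ : ℍ, ((A • τ : ℍ) : ℂ) = m τ := by
    intro τ
    rw [UpperHalfPlane.coe_specialLinearGroup_apply]
    simp [m]
  have hmU : ∀ z ∈ U, m z ∈ U := by
    intro z hz
    have := (A • (⟨z, hz⟩ : ℍ)).im_pos
    rw [← UpperHalfPlane.coe_im, hm] at this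
    exact this
  have hdetC : (A 0 0 : ℂ) * A 1 1 - A 0 1 * A 1 0 = 1 := by exact_mod_cast hdet
  have haC : (A 1 0 : ℂ) = k * formA A := by exact_mod_cast ha
  have hbC : (A 1 1 : ℂ) - A 0 0 = k * formB A := by exact_mod_cast hb
  have hcC : -(A 0 1 : ℂ) = k * formC A := by exact_mod_cast hc
  have hkC : (k : ℂ) ≠ 0 := by exact_mod_cast hk
  have hmd : ∀ z ∈ U, HasDerivAt m (1 / ((A 1 0 : ℂ) * z + A 1 1) ^ 2) z := by
    intro z hz
    have h1 : HasDerivAt (fun z : ℂ => (A 0 0 : ℂ) * z + A 0 1) (A 0 0 : ℂ) z := by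
      simpa using ((hasDerivAt_id z).const_mul (A 0 0 : ℂ)).add_const (A 0 1 : ℂ)
    have h2 : HasDerivAt (fun z : ℂ => (A 1 0 : ℂ) * z + A 1 1) (A 1 0 : ℂ) z := by
      simpa using ((hasDerivAt_id z).const_mul (A 1 0 : ℂ)).add_const (A 1 1 : ℂ)
    have h3 : (A 0 0 : ℂ) * ((A 1 0 : ℂ) * z + A 1 1) - ((A 0 0 : ℂ) * z + A 0 1) * A 1 0 = 1 := by
      linear_combination hdetC
    rw [← h3]
    exact h1.div h2 (hden z hz)
  have hinv : ∀ z ∈ U, cycleIntegrand f A (m z) * (1 / ((A 1 0 : ℂ) * z + A 1 1) ^ 2)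
      = cycleIntegrand f A z := by
    intro z hz
    have hfz : f (UpperHalfPlane.ofComplex (m z)) = f (UpperHalfPlane.ofComplex z) := by
      have e1 : UpperHalfPlane.ofComplex z = ⟨z, hz⟩ := UpperHalfPlane.ofComplex_apply ⟨z, hz⟩
      have e2 : UpperHalfPlane.ofComplex (m z) = A • (⟨z, hz⟩ : ℍ) := by
        rw [← UpperHalfPlane.ofComplex_apply (A • (⟨z, hz⟩ : ℍ)), hm]
      rw [e1, e2, hf.invariant]
    have hQm : ((formA A : ℂ) * (m z) ^ 2 + (formB A : ℂ) * (m z) + (formC A : ℂ))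
        * ((A 1 0 : ℂ) * z + A 1 1) ^ 2
        = (formA A : ℂ) * z ^ 2 + (formB A : ℂ) * z + (formC A : ℂ) := by
      have hd := hden z hz
      have e : m z * ((A 1 0 : ℂ) * z + A 1 1) = (A 0 0 : ℂ) * z + A 0 1 :=
        div_mul_cancel₀ _ hd
      apply mul_left_cancel₀ hkC
      have e3 : ∀ y : ℂ, k * ((formA A : ℂ) * y ^ 2 + (formB A : ℂ) * y + (formC A : ℂ))
          = (A 1 0 : ℂ) * y ^ 2 + ((A 1 1 : ℂ) - A 0 0) * y - A 0 1 := by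
        intro y; linear_combination -(y ^ 2) * haC - y * hbC - hcC
      rw [← mul_assoc, e3, e3]
      generalize m z = y at *
      have : ((A 1 0 : ℂ) * y ^ 2 + ((A 1 1 : ℂ) - A 0 0) * y - A 0 1)
          * ((A 1 0 : ℂ) * z + A 1 1) ^ 2
          = (A 1 0 : ℂ) * (y * ((A 1 0 : ℂ) * z + A 1 1)) ^ 2
            + ((A 1 1 : ℂ) - A 0 0) * (y * ((A 1 0 : ℂ) * z + A 1 1))
              * ((A 1 0 : ℂ) * z + A 1 1) - A 0 1 * ((A 1 0 : ℂ) * z + A 1 1) ^ 2 := by ring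
      rw [this, e]
      linear_combination
        ((A 1 0 : ℂ) * z ^ 2 + ((A 1 1 : ℂ) - A 0 0) * z - A 0 1) * hdetC
    unfold cycleIntegrand
    rw [hfz, ← hQm, div_mul_div_comm, mul_one]
  have hconst : ∀ z ∈ U, HasDerivAt (fun z => G (m z) - G z) 0 z := by
    intro z hz
    have h1 := (hG _ (hmU z hz)).comp z (hmd z hz)
    rw [hinv z hz] at h1
    have h2 := h1.sub (hG z hz)
    rw [sub_self] at h2
    exact h2
  have hI : ((UpperHalfPlane.I : ℍ) : ℂ) ∈ U := UpperHalfPlane.I.im_pos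
  have hτ : (τ₀ : ℂ) ∈ U := τ₀.im_pos
  rw [hint _ hτ _ (A • τ₀).im_pos, hint _ hI _ (A • UpperHalfPlane.I).im_pos, hm, hm]
  exact hUo.is_const_of_deriv_eq_zero hUc.isPreconnected
    (fun z hz => (hconst z hz).differentiableAt.differentiableWithinAt)
    (fun z hz => (hconst z hz).deriv) hτ hI

/-! ### Farey paths and the Lyapunov exponent -/

/-- The matrix `V = (1 0; 1 1)`; Mathlib's `ModularGroup.T` is `T = (1 1; 0 1)`. -/
def V : SL(2, ℤ) := ⟨!![1, 0; 1, 1], by simp [Matrix.det_fin_two]⟩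

theorem mul_V (A : SL(2, ℤ)) : (A * V) 0 0 = A 0 0 + A 0 1 ∧ (A * V) 0 1 = A 0 1 ∧
    (A * V) 1 0 = A 1 0 + A 1 1 ∧ (A * V) 1 1 = A 1 1 := by
  have h : ∀ i j, (A * V) i j = A i 0 * V 0 j + A i 1 * V 1 j := fun i j => by
    rw [← Fin.sum_univ_two (fun k => A i k * V k j)]; rfl
  refine ⟨?_, ?_, ?_, ?_⟩ <;> rw [h] <;> simp [V]

theorem mul_T (A : SL(2, ℤ)) : (A * ModularGroup.T) 0 0 = A 0 0 ∧
    (A * ModularGroup.T) 0 1 = A 0 0 + A 0 1 ∧ (A * ModularGroup.T) 1 0 = A 1 0 ∧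
    (A * ModularGroup.T) 1 1 = A 1 0 + A 1 1 := by
  have h : ∀ i j, (A * ModularGroup.T) i j
      = A i 0 * ModularGroup.T 0 j + A i 1 * ModularGroup.T 1 j := fun i j => by
    rw [← Fin.sum_univ_two (fun k => A i k * ModularGroup.T k j)]; rfl
  refine ⟨?_, ?_, ?_, ?_⟩ <;> rw [h] <;> simp [ModularGroup.T]

/-- The value `A(1) = (c + a) / (d + b)` of the Möbius transformation `A = (c a; d b)` at `1`: the
Farey median of `A(0) = a / b` and `A(∞) = c / d`. -/
def atOne (A : SL(2, ℤ)) : ℝ :=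
  ((A 0 0 : ℝ) + A 0 1) / ((A 1 0 : ℝ) + A 1 1)

/-- The matrices `A₀ = I, A₁, A₂, …` along the path in the Farey tree which starts at `x₀ = 1/1`
and converges to `x`, with `x_n = A_n(1)`: if `x < x_n` the path moves to the smaller direct
descendant, with matrix `A_n V`, otherwise to the larger one, with matrix `A_n T`. (If `x` is
rational, the path reaches `x`, makes one step `T` and then only steps `V`.) -/
def fareyMatrix (x : ℝ) : ℕ → SL(2, ℤ)
  | 0 => 1
  | n + 1 =>
    if x < atOne (fareyMatrix x n) then fareyMatrix x n * V
    else fareyMatrix x n * ModularGroup.T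

/-- The Farey path of `x` converges to `x`. -/
theorem tendsto_fareyMatrix {x : ℝ} (hx : 0 < x) :
    Filter.Tendsto (fun n => atOne (fareyMatrix x n)) Filter.atTop (𝓝 x) := by
  -- nonnegativity of the entries and the position of `x`
  have key : ∀ n : ℕ, 0 ≤ fareyMatrix x n 0 0 ∧ 0 ≤ fareyMatrix x n 0 1 ∧
      0 ≤ fareyMatrix x n 1 0 ∧ 1 ≤ fareyMatrix x n 1 1 ∧
      (fareyMatrix x n 0 1 : ℝ) ≤ x * fareyMatrix x n 1 1 ∧
      x * fareyMatrix x n 1 0 < fareyMatrix x n 0 0 ∧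
      (n : ℤ) + 1 ≤ fareyMatrix x n 1 0 + fareyMatrix x n 1 1 + fareyMatrix x n 0 1 := by
    intro n
    induction n with
    | zero => simp [fareyMatrix, hx.le]
    | succ n ih =>
      obtain ⟨h1, h2, h3, h4, h5, h6, h7⟩ := ih
      have h0 : 1 ≤ fareyMatrix x n 0 0 := by
        have : (0 : ℝ) < fareyMatrix x n 0 0 := by
          refine lt_of_le_of_lt ?_ h6
          have : (0 : ℝ) ≤ fareyMatrix x n 1 0 := by exact_mod_cast h3
          positivity
        exact_mod_cast this
      have hpos : (0 : ℝ) < (fareyMatrix x n 1 0 : ℝ) + fareyMatrix x n 1 1 := by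
        exact_mod_cast (by omega : 0 < fareyMatrix x n 1 0 + fareyMatrix x n 1 1)
      rw [fareyMatrix]
      split_ifs with h
      · rw [atOne, lt_div_iff₀ hpos] at h
        rw [(mul_V _).1, (mul_V _).2.1, (mul_V _).2.2.1, (mul_V _).2.2.2]
        push_cast
        exact ⟨by omega, by omega, by omega, by omega, by linarith, by linarith, by omega⟩
      · rw [atOne, not_lt, div_le_iff₀ hpos] at h
        rw [(mul_T _).1, (mul_T _).2.1, (mul_T _).2.2.1, (mul_T _).2.2.2]
        push_cast
        exact ⟨by omega, by omega, by omega, by omega, by linarith, by linarith, by omega⟩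
  have bound : ∀ n : ℕ, |atOne (fareyMatrix x n) - x| ≤ (1 + x) ^ 2 * (1 / ((n : ℝ) + 1)) := by
    intro n
    obtain ⟨h1, h2, h3, h4, h5, h6, h7⟩ := key n
    have hdet : fareyMatrix x n 0 0 * fareyMatrix x n 1 1
        - fareyMatrix x n 0 1 * fareyMatrix x n 1 0 = 1 := by
      have := (fareyMatrix x n).2; rwa [Matrix.det_fin_two] at this
    rw [atOne]
    generalize fareyMatrix x n 0 0 = p at *
    generalize fareyMatrix x n 0 1 = q at *
    generalize fareyMatrix x n 1 0 = r at *
    generalize fareyMatrix x n 1 1 = s at *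
    have hdetR : (p : ℝ) * s - q * r = 1 := by exact_mod_cast hdet
    have h3R : (0 : ℝ) ≤ r := by exact_mod_cast h3
    have h4R : (1 : ℝ) ≤ s := by exact_mod_cast h4
    have h7R : (n : ℝ) + 1 ≤ r + s + q := by exact_mod_cast h7
    have hrs : (0 : ℝ) < r + s := by linarith
    have hp : (p : ℝ) - x * r ≤ 1 := by nlinarith
    have hq : x * s - q ≤ 1 + x := by
      rcases h3.eq_or_lt with h | h
      · subst h
        have hs1 : s = 1 := by
          have : p * s = 1 := by linarith
          rcases Int.eq_one_or_neg_one_of_mul_eq_one' this with ⟨_, h⟩ | ⟨_, h⟩ <;> omega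
        subst hs1
        have : (0 : ℝ) ≤ q := by exact_mod_cast h2
        push_cast
        linarith
      · have : (1 : ℝ) ≤ r := by exact_mod_cast h
        nlinarith
    have habs : |((p : ℝ) + q) / (r + s) - x| * (r + s) ≤ 1 + x := by
      rw [← abs_of_pos hrs, ← abs_mul, abs_of_pos hrs, sub_mul, div_mul_cancel₀ _ hrs.ne', abs_le]
      constructor <;> linarith
    have hn : (0 : ℝ) < (n : ℝ) + 1 := by positivity
    rw [mul_one_div, le_div_iff₀ hn]
    have hn2 : (n : ℝ) + 1 ≤ (r + s) * (1 + x) := by nlinarith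
    calc |((p : ℝ) + q) / (r + s) - x| * (n + 1)
        ≤ |((p : ℝ) + q) / (r + s) - x| * ((r + s) * (1 + x)) :=
          mul_le_mul_of_nonneg_left hn2 (abs_nonneg _)
      _ = (|((p : ℝ) + q) / (r + s) - x| * (r + s)) * (1 + x) := by ring
      _ ≤ (1 + x) * (1 + x) := mul_le_mul_of_nonneg_right habs (by linarith)
      _ = (1 + x) ^ 2 := by ring
  rw [tendsto_iff_dist_tendsto_zero]
  have lim := tendsto_one_div_add_atTop_nhds_zero_nat (𝕜 := ℝ) |>.const_mul ((1 + x) ^ 2)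
  rw [mul_zero] at lim
  exact squeeze_zero (fun _ => dist_nonneg) (fun n => by rw [Real.dist_eq]; exact bound n) lim

/-- The `f`-Lyapunov exponent `Λ_f(x) = limsup Re(I_f(A_n)) / n`, where `A_n` is the sequence of
matrices of the Farey path of `x` if `x > 0`, extended to all real `x` by `Λ_f(-x) = Λ_f(x)`.
(For `x = 0` all the `A_n = V ^ n` are parabolic and the value is `0`.) The limit superior is taken
in the extended reals. -/
def lyapunov (f : ℍ → ℂ) (x : ℝ) : EReal :=
  Filter.limsup
    (fun n : ℕ => (((cycleIntegral f (fareyMatrix |x| n)).re / (n : ℝ) : ℝ) : EReal)) Filter.atTop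

/-! ### Continued fractions -/

/-- `x` has the infinite simple continued fraction expansion `[d 0; d 1, d 2, …]`. (The partial
quotients `d n` with `n ≥ 1` of such an expansion are positive integers.) -/
def HasContFract (x : ℝ) (d : ℕ → ℤ) : Prop :=
  (GenContFract.of x).h = d 0 ∧
    ∀ n : ℕ, (GenContFract.of x).s.get? n = some ⟨1, (d (n + 1) : ℝ)⟩

/-- The eventually periodic sequence `a₁, …, a_r, b₁, …, b_ℓ, b₁, …, b_ℓ, …`, indexed from `0`. -/
def eventuallyPeriodic (a : List ℤ) (b : List ℕ) (n : ℕ) : ℤ :=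
  if n < a.length then a.getD n 0 else (b.getD ((n - a.length) % b.length) 0 : ℕ)

/-- The word `T ^ b₁ V ^ b₂ T ^ b₃ V ^ b₄ ⋯`. -/
def word : List ℕ → SL(2, ℤ)
  | [] => 1
  | [b] => ModularGroup.T ^ b
  | b :: c :: l => ModularGroup.T ^ b * V ^ c * word l

end ModularLyapunov

end

/-! Both letters `T` and `V` send `ω = e^{2πi/3}` to `e^{πi/3}` (`letter_smul_arcPoint`). For a word
`A` of length `n` with prefixes `A_k`, the path from `ω` to `A ω` can therefore be taken through the
points `A_k ω`, and its pieces are the images under `A_k` of one fixed arc. If both off-diagonal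
entries of `A` are positive, the zeros of `Q` are the positive fixed point `v` of `A` and `-u`, with
`u` the positive fixed point of the reversed word, and `√D / Q dτ = dτ / (τ + u) - dτ / (τ - v)`.
Pulling a piece back by `A_k` preserves this shape, with `v` replaced by `v_k = A_k⁻¹ v` and `u` by
`u_k = rev(A_k) u`. Since `f` is invariant, and real on the arc, the real part of the piece is the
integral of `f` against a positive kernel. So `Re I_f(A)` is a sum of `n` terms `arcIntegral f v_k
u_k` (`re_cycleIntegral_fareyMatrix`), each of them positive (`arcIntegral_pos`).

These terms are Lipschitz in `v / (1 + v)` and `u / (1 + u)`, and a word of length `n` contracts the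
half line in this coordinate to diameter at most `1 / (n + 1)`. Along an eventually periodic path,
`v_k` is thus close to the Farey iterate of the end of the path and `u_k` to a periodic sequence,
with errors of order `1 / (n - k)` and `1 / k`. The total error is a harmonic sum, hence `o(n)`,
while the periodic model sums over one period to `Re I_f` of the period word. The limsup is in fact
a limit (`tendsto_re_cycleIntegral_div`).

The arithmetic input is that the Farey path is the itinerary of the Farey map, whose orbit meets the
complete quotients of the continued fraction up to inversion (`fareyMatrix_eq_word`, `reaches_abs`).
Inversion exchanges `T` and `V`, and by the symmetry of the kernel it does not change the sums
(`re_cycleIntegral_inv`). -/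

noncomputable section

namespace ModularLyapunov

/-! ### Matrices with non-negative entries -/

/-- The matrices of `SL(2, ℤ)` with non-negative entries and positive diagonal. -/
structure IsFareyMatrix (M : SL(2, ℤ)) : Prop where
  p : 1 ≤ M 0 0
  q : 0 ≤ M 0 1
  r : 0 ≤ M 1 0
  s : 1 ≤ M 1 1

/-- The fractional linear action on real numbers. -/
def mob (M : SL(2, ℤ)) (v : ℝ) : ℝ :=
  ((M 0 0 : ℝ) * v + M 0 1) / ((M 1 0 : ℝ) * v + M 1 1)

/-- Exchange of the diagonal entries; it reverses words in `T` and `V`. -/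
def rev (M : SL(2, ℤ)) : SL(2, ℤ) :=
  ⟨!![M 1 1, M 0 1; M 1 0, M 0 0], by
    have := M.2
    rw [Matrix.det_fin_two] at this ⊢
    simp only [Matrix.of_apply, Matrix.cons_val', Matrix.cons_val_zero, Matrix.cons_val_one,
      Matrix.cons_val_fin_one]
    linarith⟩

/-- Conjugation by `(0 1; 1 0)`; it exchanges `T` and `V`. -/
def swap (M : SL(2, ℤ)) : SL(2, ℤ) :=
  ⟨!![M 1 1, M 1 0; M 0 1, M 0 0], by
    have := M.2
    rw [Matrix.det_fin_two] at this ⊢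
    simp only [Matrix.of_apply, Matrix.cons_val', Matrix.cons_val_zero, Matrix.cons_val_one,
      Matrix.cons_val_fin_one]
    linarith⟩

@[simp] theorem rev_00 (M : SL(2, ℤ)) : rev M 0 0 = M 1 1 := rfl
@[simp] theorem rev_01 (M : SL(2, ℤ)) : rev M 0 1 = M 0 1 := rfl
@[simp] theorem rev_10 (M : SL(2, ℤ)) : rev M 1 0 = M 1 0 := rfl
@[simp] theorem rev_11 (M : SL(2, ℤ)) : rev M 1 1 = M 0 0 := rfl
@[simp] theorem swap_00 (M : SL(2, ℤ)) : swap M 0 0 = M 1 1 := rfl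
@[simp] theorem swap_01 (M : SL(2, ℤ)) : swap M 0 1 = M 1 0 := rfl
@[simp] theorem swap_10 (M : SL(2, ℤ)) : swap M 1 0 = M 0 1 := rfl
@[simp] theorem swap_11 (M : SL(2, ℤ)) : swap M 1 1 = M 0 0 := rfl

theorem mul_apply_two (A B : SL(2, ℤ)) (i j : Fin 2) :
    (A * B) i j = A i 0 * B 0 j + A i 1 * B 1 j := by
  rw [← Fin.sum_univ_two (fun k => A i k * B k j)]; rfl

theorem ext_two {A B : SL(2, ℤ)} (h0 : A 0 0 = B 0 0) (h1 : A 0 1 = B 0 1) (h2 : A 1 0 = B 1 0)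
    (h3 : A 1 1 = B 1 1) : A = B := by
  ext i j
  fin_cases i <;> fin_cases j <;> assumption

theorem det_two (M : SL(2, ℤ)) : M 0 0 * M 1 1 - M 0 1 * M 1 0 = 1 := by
  have := M.2; rwa [Matrix.det_fin_two] at this

theorem rev_mul (A B : SL(2, ℤ)) : rev (A * B) = rev B * rev A := by
  apply ext_two <;> simp only [mul_apply_two, rev_00, rev_01, rev_10, rev_11] <;> ring

theorem swap_mul (A B : SL(2, ℤ)) : swap (A * B) = swap A * swap B := by
  apply ext_two <;> simp only [mul_apply_two, swap_00, swap_01, swap_10, swap_11] <;> ring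

theorem swap_one : swap 1 = 1 := by
  apply ext_two <;> simp

theorem rev_swap (A : SL(2, ℤ)) : rev (swap A) = swap (rev A) := rfl

theorem swap_T : swap ModularGroup.T = V := by
  apply ext_two <;> rfl

theorem swap_V : swap V = ModularGroup.T := by
  apply ext_two <;> rfl

theorem swap_T_pow (n : ℕ) : swap (ModularGroup.T ^ n) = V ^ n := by
  induction n with
  | zero => simpa using swap_one
  | succ n ih => rw [pow_succ, pow_succ, swap_mul, ih, swap_T]

namespace IsFareyMatrix

variable {M N : SL(2, ℤ)}

theorem one : IsFareyMatrix 1 := by constructor <;> simp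

theorem T : IsFareyMatrix ModularGroup.T := by constructor <;> simp [ModularGroup.T]

theorem V : IsFareyMatrix V := by constructor <;> simp [ModularLyapunov.V]

theorem mul (hM : IsFareyMatrix M) (hN : IsFareyMatrix N) : IsFareyMatrix (M * N) := by
  obtain ⟨h1, h2, h3, h4⟩ := hM
  obtain ⟨k1, k2, k3, k4⟩ := hN
  constructor <;> rw [mul_apply_two] <;> nlinarith [mul_nonneg h2 k3, mul_nonneg h3 k2]

theorem rev (hM : IsFareyMatrix M) : IsFareyMatrix (rev M) := ⟨hM.s, hM.q, hM.r, hM.p⟩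

theorem swap (hM : IsFareyMatrix M) : IsFareyMatrix (swap M) := ⟨hM.s, hM.r, hM.q, hM.p⟩

theorem castReal (hM : IsFareyMatrix M) :
    (1 : ℝ) ≤ M 0 0 ∧ (0 : ℝ) ≤ M 0 1 ∧ (0 : ℝ) ≤ M 1 0 ∧ (1 : ℝ) ≤ M 1 1 :=
  ⟨by exact_mod_cast hM.p, by exact_mod_cast hM.q, by exact_mod_cast hM.r, by exact_mod_cast hM.s⟩

theorem num_pos (hM : IsFareyMatrix M) {v : ℝ} (hv : 0 < v) : 0 < (M 0 0 : ℝ) * v + M 0 1 := by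
  obtain ⟨h1, h2, -, -⟩ := hM.castReal
  positivity

theorem denom_pos (hM : IsFareyMatrix M) {v : ℝ} (hv : 0 < v) :
    0 < (M 1 0 : ℝ) * v + M 1 1 := by
  obtain ⟨-, -, h1, h2⟩ := hM.castReal
  positivity

theorem mob_pos (hM : IsFareyMatrix M) {v : ℝ} (hv : 0 < v) : 0 < mob M v :=
  div_pos (hM.num_pos hv) (hM.denom_pos hv)

/-- The diagonal of `M` is at least `1`, so a positive off-diagonal entry of `N` survives as a
summand of the product. This makes every path containing a full period hyperbolic. -/
theorem off_diag_mul_left (hM : IsFareyMatrix M) (hN : IsFareyMatrix N)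
    (h : 0 < N 0 1 ∧ 0 < N 1 0) : 0 < (M * N) 0 1 ∧ 0 < (M * N) 1 0 := by
  obtain ⟨h1, h2, h3, h4⟩ := hM
  obtain ⟨k1, k2, k3, k4⟩ := hN
  obtain ⟨l1, l2⟩ := h
  constructor <;> rw [mul_apply_two] <;> nlinarith

theorem off_diag_mul_right (hM : IsFareyMatrix M) (hN : IsFareyMatrix N)
    (h : 0 < M 0 1 ∧ 0 < M 1 0) : 0 < (M * N) 0 1 ∧ 0 < (M * N) 1 0 := by
  obtain ⟨h1, h2, h3, h4⟩ := hM
  obtain ⟨k1, k2, k3, k4⟩ := hN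
  obtain ⟨l1, l2⟩ := h
  constructor <;> rw [mul_apply_two] <;> nlinarith

end IsFareyMatrix

theorem mob_mul {M N : SL(2, ℤ)} (hM : IsFareyMatrix M) (hN : IsFareyMatrix N) {v : ℝ}
    (hv : 0 < v) : mob (M * N) v = mob M (mob N v) := by
  have h1 := (hN.denom_pos hv).ne'
  have h2 := (hM.denom_pos (hN.mob_pos hv)).ne'
  have h3 := ((hM.mul hN).denom_pos hv).ne'
  rw [mob, mob, div_eq_div_iff h3 h2, mob]
  simp only [mul_apply_two]
  push_cast
  field_simp
  ring

theorem mob_one (v : ℝ) : mob 1 v = v := by simp [mob]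

theorem mob_swap (M : SL(2, ℤ)) {v : ℝ} (hv : 0 < v) :
    mob (swap M) v⁻¹ = (mob M v)⁻¹ := by
  have e1 : (M 1 1 : ℝ) * v⁻¹ + M 1 0 = (M 1 0 * v + M 1 1) / v := by field_simp; ring
  have e2 : (M 0 1 : ℝ) * v⁻¹ + M 0 0 = (M 0 0 * v + M 0 1) / v := by field_simp; ring
  rw [mob, mob, swap_00, swap_01, swap_10, swap_11, e1, e2, div_div_div_cancel_right₀ hv.ne',
    inv_div]

/-- A non-negative matrix with positive off-diagonal entries has at most one positive fixed
point. -/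
theorem mob_fixed_unique {M : SL(2, ℤ)} (hM : IsFareyMatrix M) (hq : 0 < M 0 1) {v w : ℝ}
    (hv : 0 < v) (hw : 0 < w) (h1 : mob M v = v) (h2 : mob M w = w) : v = w := by
  rw [mob, div_eq_iff (hM.denom_pos hv).ne'] at h1
  rw [mob, div_eq_iff (hM.denom_pos hw).ne'] at h2
  have hq' : (0 : ℝ) < M 0 1 := by exact_mod_cast hq
  have hr' := hM.castReal.2.2.1
  -- The two quadratic fixed point equations are combined so that their linear terms cancel; the
  -- second factor is positive.
  have h : (v - w) * (M 0 1 + M 1 0 * (v * w)) = 0 := by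
    linear_combination v * h2 - w * h1
  rcases mul_eq_zero.1 h with h | h
  · linarith
  · have : 0 ≤ (M 1 0 : ℝ) * (v * w) := by positivity
    linarith

/-! ### Distances after the action of a non-negative matrix -/

/-- A non-negative matrix with large entries contracts the half line `(0, ∞)`, in the coordinate
`v / (1 + v)`. -/
theorem abs_mob_sub_mob_le {M : SL(2, ℤ)} (hM : IsFareyMatrix M) {n : ℕ}
    (hn : (n : ℤ) + 2 ≤ M 0 0 + M 0 1 + M 1 0 + M 1 1) {v w : ℝ} (hv : 0 < v) (hw : 0 < w) :
    |mob M v / (1 + mob M v) - mob M w / (1 + mob M w)| ≤ 1 / ((n : ℝ) + 1) := by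
  obtain ⟨h1, h2, h3, h4⟩ := hM.castReal
  have hdet : (M 0 0 : ℝ) * M 1 1 - M 0 1 * M 1 0 = 1 := by exact_mod_cast det_two M
  have hnR : (n : ℝ) + 2 ≤ M 0 0 + M 0 1 + M 1 0 + M 1 1 := by exact_mod_cast hn
  -- In the coordinate `v / (1 + v)` the denominator has the two column sums of `M` as coefficients.
  have e : ∀ v : ℝ, 0 < v → mob M v / (1 + mob M v) = ((M 0 0 : ℝ) * v + M 0 1) /
      (((M 0 0 : ℝ) + M 1 0) * v + (M 0 1 + M 1 1)) := by
    intro v hv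
    have hd := hM.denom_pos hv
    have h : 1 + mob M v = (((M 0 0 : ℝ) + M 1 0) * v + (M 0 1 + M 1 1)) /
        ((M 1 0 : ℝ) * v + M 1 1) := by
      rw [mob, eq_div_iff hd.ne', add_mul, div_mul_cancel₀ _ hd.ne']
      ring
    rw [h, mob, div_div_div_cancel_right₀ hd.ne']
  rw [e v hv, e w hw]
  generalize (M 0 0 : ℝ) = p at *
  generalize (M 0 1 : ℝ) = q at *
  generalize (M 1 0 : ℝ) = r at *
  generalize (M 1 1 : ℝ) = s at *
  have hc1 : 1 ≤ p + r := by linarith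
  have hc2 : 1 ≤ q + s := by linarith
  have hdv : 0 < (p + r) * v + (q + s) := by positivity
  have hdw : 0 < (p + r) * w + (q + s) := by positivity
  have e1 : (p * v + q) / ((p + r) * v + (q + s)) - (p * w + q) / ((p + r) * w + (q + s))
      = (v - w) / (((p + r) * v + (q + s)) * ((p + r) * w + (q + s))) := by
    rw [div_sub_div _ _ hdv.ne' hdw.ne']
    congr 1
    linear_combination (v - w) * hdet
  have hn0 : (0 : ℝ) < (n : ℝ) + 1 := by positivity
  rw [e1, abs_div, abs_of_pos (mul_pos hdv hdw), div_le_div_iff₀ (mul_pos hdv hdw) hn0, one_mul]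
  -- Both column sums are at least `1`, so their product is at least their sum minus `1`.
  have hcc : (n : ℝ) + 1 ≤ (p + r) * (q + s) := by nlinarith
  have habs : |v - w| ≤ v + w := abs_le.2 ⟨by linarith, by linarith⟩
  calc |v - w| * (n + 1) ≤ (v + w) * ((p + r) * (q + s)) := by gcongr
    _ ≤ ((p + r) * v + (q + s)) * ((p + r) * w + (q + s)) := by
      have : 0 ≤ (p + r) ^ 2 * (v * w) + (q + s) ^ 2 := by positivity
      nlinarith

/-! ### The Farey map -/

/-- The Farey map on the positive half line. -/
def fareyMap (x : ℝ) : ℝ := if x < 1 then x / (1 - x) else x - 1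

/-- The first letter of the Farey path of `x`. -/
def fareyLetter (x : ℝ) : SL(2, ℤ) := if x < 1 then V else ModularGroup.T

theorem isFareyMatrix_letter (x : ℝ) : IsFareyMatrix (fareyLetter x) := by
  unfold fareyLetter
  split_ifs
  · exact .V
  · exact .T

theorem mob_T (v : ℝ) : mob ModularGroup.T v = v + 1 := by simp [mob, ModularGroup.T]

theorem mob_V (v : ℝ) : mob V v = v / (v + 1) := by simp [mob, V]

theorem atOne_eq_mob (A : SL(2, ℤ)) : atOne A = mob A 1 := by simp [atOne, mob]

theorem isFareyMatrix_fareyMatrix (x : ℝ) (n : ℕ) : IsFareyMatrix (fareyMatrix x n) := by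
  induction n with
  | zero => exact .one
  | succ n ih =>
    rw [fareyMatrix]
    split_ifs
    · exact ih.mul .V
    · exact ih.mul .T

/-- Each letter adds one column to the other, and a column has sum at least `1`. This is the growth
hypothesis of `abs_mob_sub_mob_le`. -/
theorem fareyMatrix_sum (x : ℝ) (n : ℕ) : (n : ℤ) + 2 ≤
    fareyMatrix x n 0 0 + fareyMatrix x n 0 1 + fareyMatrix x n 1 0 + fareyMatrix x n 1 1 := by
  induction n with
  | zero => simp [fareyMatrix]
  | succ n ih =>
    obtain ⟨h1, h2, h3, h4⟩ := isFareyMatrix_fareyMatrix x n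
    rw [fareyMatrix]
    split_ifs
    · rw [(mul_V _).1, (mul_V _).2.1, (mul_V _).2.2.1, (mul_V _).2.2.2]
      push_cast
      linarith
    · rw [(mul_T _).1, (mul_T _).2.1, (mul_T _).2.2.1, (mul_T _).2.2.2]
      push_cast
      linarith

/-- The Farey map undoes the first letter by an increasing branch, so the comparisons that decide
the later turns of the path can be made at `fareyMap x`. -/
theorem lt_mob_fareyLetter_iff (x : ℝ) {y : ℝ} (hy : 0 < y) :
    x < mob (fareyLetter x) y ↔ fareyMap x < y := by
  unfold fareyLetter fareyMap
  split_ifs with h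
  · rw [mob_V, lt_div_iff₀ (by linarith), div_lt_iff₀ (by linarith)]
    constructor <;> intro h <;> linarith
  · rw [mob_T]
    constructor <;> intro h <;> linarith

/-- The definition appends letters on the right, always comparing with `x` itself. Splitting off the
first letter on the left instead turns the path into the itinerary of the Farey map. -/
theorem fareyMatrix_succ' (x : ℝ) (n : ℕ) :
    fareyMatrix x (n + 1) = fareyLetter x * fareyMatrix (fareyMap x) n := by
  induction n with
  | zero => simp [fareyMatrix, fareyLetter, atOne]
  | succ n ih =>
    have hM := isFareyMatrix_fareyMatrix (fareyMap x) n
    have h : x < atOne (fareyMatrix x (n + 1)) ↔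
        fareyMap x < atOne (fareyMatrix (fareyMap x) n) := by
      rw [ih, atOne_eq_mob, atOne_eq_mob, mob_mul (isFareyMatrix_letter x) hM one_pos,
        lt_mob_fareyLetter_iff x (hM.mob_pos one_pos)]
    have e : ∀ y k, fareyMatrix y (k + 1) = if y < atOne (fareyMatrix y k) then
      fareyMatrix y k * V else fareyMatrix y k * ModularGroup.T := fun _ _ => rfl
    rw [e x (n + 1), e (fareyMap x) n]
    simp only [h]
    rw [ih]
    split_ifs <;> rw [mul_assoc]

theorem fareyMatrix_add (x : ℝ) (m n : ℕ) :
    fareyMatrix x (m + n) = fareyMatrix x m * fareyMatrix (fareyMap^[m] x) n := by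
  induction m generalizing x with
  | zero => simp [fareyMatrix]
  | succ m ih =>
    rw [Nat.add_right_comm, fareyMatrix_succ', ih, fareyMatrix_succ', Function.iterate_succ_apply,
      mul_assoc]

theorem fareyMap_pos {x : ℝ} (hx : 0 < x) (hi : Irrational x) : 0 < fareyMap x := by
  unfold fareyMap
  split_ifs with h
  · exact div_pos hx (by linarith)
  · have : x ≠ 1 := by simpa using hi.ne_nat 1
    have := lt_of_le_of_ne (not_lt.1 h) this.symm
    linarith

theorem mob_fareyLetter (x : ℝ) : mob (fareyLetter x) (fareyMap x) = x := by
  unfold fareyLetter fareyMap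
  split_ifs with h
  · have : (1 : ℝ) - x ≠ 0 := by linarith
    rw [mob_V]
    field_simp
    ring
  · rw [mob_T]; ring

theorem irrational_fareyMap {x : ℝ} (hi : Irrational x) : Irrational (fareyMap x) := by
  rintro ⟨y, hy⟩
  have h := mob_fareyLetter x
  rw [← hy, mob] at h
  apply hi
  rw [← h]
  exact ⟨((fareyLetter x 0 0 : ℚ) * y + fareyLetter x 0 1) /
    ((fareyLetter x 1 0 : ℚ) * y + fareyLetter x 1 1), by push_cast; rfl⟩

theorem fareyMap_iterate {x : ℝ} (hx : 0 < x) (hi : Irrational x) (n : ℕ) :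
    0 < fareyMap^[n] x ∧ Irrational (fareyMap^[n] x) := by
  induction n with
  | zero => exact ⟨hx, hi⟩
  | succ n ih =>
    rw [Function.iterate_succ_apply']
    exact ⟨fareyMap_pos ih.1 ih.2, irrational_fareyMap ih.2⟩

theorem mob_fareyMatrix_iterate {x : ℝ} (hx : 0 < x) (hi : Irrational x) (n : ℕ) :
    mob (fareyMatrix x n) (fareyMap^[n] x) = x := by
  induction n generalizing x with
  | zero => simp [fareyMatrix, mob_one]
  | succ n ih =>
    have h1 := fareyMap_pos hx hi
    have h2 := irrational_fareyMap hi
    rw [fareyMatrix_succ', Function.iterate_succ_apply,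
      mob_mul (isFareyMatrix_letter x) (isFareyMatrix_fareyMatrix _ n) (fareyMap_iterate h1 h2 n).1,
      ih h1 h2, mob_fareyLetter]

/-- Inversion exchanges `(0, 1)` with `(1, ∞)` and with them the two branches. Only the point `1`,
assigned to one side by convention, breaks the symmetry, and irrationality excludes it. -/
theorem fareyMap_inv {x : ℝ} (hx : 0 < x) (hi : Irrational x) :
    fareyMap x⁻¹ = (fareyMap x)⁻¹ := by
  have h1 : x ≠ 1 := by simpa using hi.ne_nat 1
  rcases lt_or_gt_of_ne h1 with h | h
  · have h2 : ¬ x⁻¹ < 1 := not_lt.2 (one_le_inv_iff₀.2 ⟨hx, h.le⟩)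
    rw [fareyMap, fareyMap, if_pos h, if_neg h2]
    field_simp
  · have h2 : x⁻¹ < 1 := inv_lt_one_of_one_lt₀ h
    rw [fareyMap, fareyMap, if_pos h2, if_neg h.le.not_gt]
    have : x - 1 ≠ 0 := by linarith
    field_simp

theorem fareyLetter_inv {x : ℝ} (hx : 0 < x) (hi : Irrational x) :
    fareyLetter x⁻¹ = swap (fareyLetter x) := by
  have h1 : x ≠ 1 := by simpa using hi.ne_nat 1
  rcases lt_or_gt_of_ne h1 with h | h
  · have h2 : ¬ x⁻¹ < 1 := not_lt.2 (one_le_inv_iff₀.2 ⟨hx, h.le⟩)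
    rw [fareyLetter, fareyLetter, if_pos h, if_neg h2, swap_V]
  · have h2 : x⁻¹ < 1 := inv_lt_one_of_one_lt₀ h
    rw [fareyLetter, fareyLetter, if_pos h2, if_neg h.le.not_gt, swap_T]

theorem fareyMap_iterate_inv {x : ℝ} (hx : 0 < x) (hi : Irrational x) (n : ℕ) :
    fareyMap^[n] x⁻¹ = (fareyMap^[n] x)⁻¹ := by
  induction n with
  | zero => rfl
  | succ n ih =>
    obtain ⟨h1, h2⟩ := fareyMap_iterate hx hi n
    rw [Function.iterate_succ_apply', Function.iterate_succ_apply', ih, fareyMap_inv h1 h2]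

theorem fareyMatrix_inv {x : ℝ} (hx : 0 < x) (hi : Irrational x) (n : ℕ) :
    fareyMatrix x⁻¹ n = swap (fareyMatrix x n) := by
  induction n generalizing x with
  | zero => exact swap_one.symm
  | succ n ih =>
    rw [fareyMatrix_succ', fareyMatrix_succ', swap_mul, fareyLetter_inv hx hi, fareyMap_inv hx hi,
      ih (fareyMap_pos hx hi) (irrational_fareyMap hi)]

theorem fareyMap_iterate_of_le_floor {x : ℝ} (n : ℕ) (hn : (n : ℝ) ≤ x) :
    fareyMap^[n] x = x - n ∧ fareyMatrix x n = ModularGroup.T ^ n := by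
  induction n generalizing x with
  | zero => simp [fareyMatrix]
  | succ n ih =>
    push_cast at hn
    have h1 : ¬ x < 1 := by
      have : (0 : ℝ) ≤ n := by positivity
      linarith
    have h2 : fareyMap x = x - 1 := by rw [fareyMap, if_neg h1]
    have h3 : fareyLetter x = ModularGroup.T := by rw [fareyLetter, if_neg h1]
    obtain ⟨h4, h5⟩ := ih (x := x - 1) (by linarith)
    rw [Function.iterate_succ_apply, fareyMatrix_succ', h2, h3, h4, h5]
    refine ⟨by push_cast; ring, (pow_succ' _ _).symm⟩

/-! ### The kernel on the arc -/

/-- The kernel `v / |v - e^{it}|²` with `c = cos t`. -/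
def arcKernel (c v : ℝ) : ℝ := v / (v ^ 2 - 2 * c * v + 1)

/-- At the worst case `c = 1/2` the right side is `((1 + v)² + 3 (1 - v)²) / 4`. -/
theorem arcKernel_denom_ge {c v : ℝ} (hc : |c| ≤ 1 / 2) (hv : 0 ≤ v) :
    (1 + v) ^ 2 / 4 ≤ v ^ 2 - 2 * c * v + 1 := by
  have := (abs_le.1 hc).2
  nlinarith [sq_nonneg (v - 1), mul_le_mul_of_nonneg_right this hv]

theorem arcKernel_pos {c v : ℝ} (hc : |c| ≤ 1 / 2) (hv : 0 < v) : 0 < arcKernel c v := by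
  have := arcKernel_denom_ge hc hv.le
  exact div_pos hv (lt_of_lt_of_le (by positivity) this)

/-- The kernel is `1 / (v + 1/v - 2 c)`, symmetric in `v` and `1/v`. The symmetry between `T` and
`V` rests on this. -/
theorem arcKernel_inv {v : ℝ} (c : ℝ) (hv : 0 < v) : arcKernel c v⁻¹ = arcKernel c v := by
  have e : v⁻¹ ^ 2 - 2 * c * v⁻¹ + 1 = (v ^ 2 - 2 * c * v + 1) / v ^ 2 := by field_simp; ring
  rw [arcKernel, arcKernel, e]
  rcases eq_or_ne (v ^ 2 - 2 * c * v + 1) 0 with h | h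
  · rw [h]; simp
  · field_simp

/-- The difference of the kernels has numerator `(v - w) (1 - v w)`, and `|1 - v w| ≤ (1 + v) (1 +
w)`. The constant `16` collects the factor `4` of `arcKernel_denom_ge` from each denominator. -/
theorem abs_arcKernel_sub_le {c v w : ℝ} (hc : |c| ≤ 1 / 2) (hv : 0 < v) (hw : 0 < w) :
    |arcKernel c v - arcKernel c w| ≤ 16 * |v / (1 + v) - w / (1 + w)| := by
  have h1 := arcKernel_denom_ge hc hv.le
  have h2 := arcKernel_denom_ge hc hw.le
  have p1 : 0 < v ^ 2 - 2 * c * v + 1 := lt_of_lt_of_le (by positivity) h1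
  have p2 : 0 < w ^ 2 - 2 * c * w + 1 := lt_of_lt_of_le (by positivity) h2
  have e1 : arcKernel c v - arcKernel c w = (v - w) * (1 - v * w) /
      ((v ^ 2 - 2 * c * v + 1) * (w ^ 2 - 2 * c * w + 1)) := by
    rw [arcKernel, arcKernel, div_sub_div _ _ p1.ne' p2.ne']
    congr 1
    ring
  have e2 : v / (1 + v) - w / (1 + w) = (v - w) / ((1 + v) * (1 + w)) := by
    rw [div_sub_div _ _ (by positivity) (by positivity)]
    congr 1
    ring
  have h3 : |1 - v * w| ≤ (1 + v) * (1 + w) := by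
    have := mul_pos hv hw
    exact abs_le.2 ⟨by nlinarith, by nlinarith⟩
  have h4 : ((1 + v) * (1 + w)) ^ 2 / 16 ≤
      (v ^ 2 - 2 * c * v + 1) * (w ^ 2 - 2 * c * w + 1) := by
    calc ((1 + v) * (1 + w)) ^ 2 / 16 = ((1 + v) ^ 2 / 4) * ((1 + w) ^ 2 / 4) := by ring
      _ ≤ _ := mul_le_mul h1 h2 (by positivity) p1.le
  have p3 : 0 < (1 + v) * (1 + w) := by positivity
  rw [e1, e2, abs_div, abs_div, abs_mul, abs_of_pos (mul_pos p1 p2), abs_of_pos p3, mul_div_assoc',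
    div_le_div_iff₀ (mul_pos p1 p2) p3]
  calc |v - w| * |1 - v * w| * ((1 + v) * (1 + w))
      ≤ |v - w| * ((1 + v) * (1 + w)) * ((1 + v) * (1 + w)) := by gcongr
    _ = 16 * |v - w| * (((1 + v) * (1 + w)) ^ 2 / 16) := by ring
    _ ≤ _ := by gcongr

/-! ### The arc -/

/-- The point `e^{it}` of the upper half plane, for `0 < t < π`. -/
def arcPoint (t : ℝ) : ℍ := UpperHalfPlane.ofComplex (Complex.exp (t * Complex.I))

theorem sin_pos_of_mem_arc {t : ℝ} (ht : t ∈ Set.Icc (Real.pi / 3) (2 * Real.pi / 3)) :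
    0 < Real.sin t :=
  Real.sin_pos_of_pos_of_lt_pi (by linarith [ht.1, Real.pi_pos]) (by linarith [ht.2, Real.pi_pos])

theorem abs_cos_le_of_mem_arc {t : ℝ} (ht : t ∈ Set.Icc (Real.pi / 3) (2 * Real.pi / 3)) :
    |Real.cos t| ≤ 1 / 2 := by
  have hpi := Real.pi_pos
  have h1 : Real.cos t ≤ Real.cos (Real.pi / 3) :=
    Real.cos_le_cos_of_nonneg_of_le_pi (by linarith) (by linarith [ht.2]) ht.1
  have h2 : Real.cos (2 * Real.pi / 3) ≤ Real.cos t :=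
    Real.cos_le_cos_of_nonneg_of_le_pi (by linarith [ht.1]) (by linarith) ht.2
  have h3 : Real.cos (2 * Real.pi / 3) = -(1 / 2) := by
    rw [show 2 * Real.pi / 3 = Real.pi - Real.pi / 3 by ring, Real.cos_pi_sub,
      Real.cos_pi_div_three]
  rw [Real.cos_pi_div_three] at h1
  exact abs_le.2 ⟨by linarith, h1⟩

theorem exp_mul_I_im (t : ℝ) : (Complex.exp (t * Complex.I)).im = Real.sin t :=
  Complex.exp_ofReal_mul_I_im t

theorem coe_arcPoint {t : ℝ} (ht : t ∈ Set.Icc (Real.pi / 3) (2 * Real.pi / 3)) :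
    (arcPoint t : ℂ) = Complex.exp (t * Complex.I) := by
  have : 0 < (Complex.exp (t * Complex.I)).im := by
    rw [exp_mul_I_im]; exact sin_pos_of_mem_arc ht
  rw [arcPoint, UpperHalfPlane.ofComplex_apply_of_im_pos this]

theorem left_mem_arc : Real.pi / 3 ∈ Set.Icc (Real.pi / 3) (2 * Real.pi / 3) :=
  ⟨le_rfl, by linarith [Real.pi_pos]⟩

theorem right_mem_arc : 2 * Real.pi / 3 ∈ Set.Icc (Real.pi / 3) (2 * Real.pi / 3) :=
  ⟨by linarith [Real.pi_pos], le_rfl⟩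

theorem exp_right : Complex.exp ((2 * Real.pi / 3 : ℝ) * Complex.I) + 1
    = Complex.exp ((Real.pi / 3 : ℝ) * Complex.I) := by
  have h : Real.sin (2 * Real.pi / 3) = Real.sin (Real.pi / 3) := by
    rw [show 2 * Real.pi / 3 = Real.pi - Real.pi / 3 by ring, Real.sin_pi_sub]
  have h' : Real.cos (2 * Real.pi / 3) = -Real.cos (Real.pi / 3) := by
    rw [show 2 * Real.pi / 3 = Real.pi - Real.pi / 3 by ring, Real.cos_pi_sub]
  apply Complex.ext
  · rw [Complex.add_re, Complex.exp_ofReal_mul_I_re, Complex.exp_ofReal_mul_I_re, h',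
      Real.cos_pi_div_three]
    norm_num
  · rw [Complex.add_im, Complex.exp_ofReal_mul_I_im, Complex.exp_ofReal_mul_I_im, h]
    simp

/-- With `ζ = e^{πi/3}` and `ω = ζ²`, one has `ω + 1 = ζ` and `ω / (ω + 1) = ζ² / ζ = ζ`. Whichever
letter comes next, the path runs along a translate of the same arc. -/
theorem letter_smul_arcPoint (x : ℝ) :
    fareyLetter x • arcPoint (2 * Real.pi / 3) = arcPoint (Real.pi / 3) := by
  apply UpperHalfPlane.ext
  rw [UpperHalfPlane.coe_specialLinearGroup_apply, coe_arcPoint left_mem_arc,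
    coe_arcPoint right_mem_arc, ← exp_right]
  unfold fareyLetter
  split_ifs
  · have h := exp_right
    have hne : Complex.exp ((2 * Real.pi / 3 : ℝ) * Complex.I) + 1 ≠ 0 := by
      rw [h]; exact Complex.exp_ne_zero _
    have hsq : Complex.exp ((2 * Real.pi / 3 : ℝ) * Complex.I)
        = Complex.exp ((Real.pi / 3 : ℝ) * Complex.I) ^ 2 := by
      rw [← Complex.exp_nat_mul]; congr 1; push_cast; ring
    simp only [V]
    simp
    push_cast at *
    rw [div_eq_iff hne, h, hsq]
    ring
  · simp [ModularGroup.T]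

theorem differentiableOn_comp_ofComplex {f : ℍ → ℂ} (hf : IsWeaklyHolomorphicModularFunction f) :
    DifferentiableOn ℂ (fun z => f (UpperHalfPlane.ofComplex z)) {z | 0 < z.im} :=
  UpperHalfPlane.mdifferentiable_iff.1 hf.holomorphic

theorem continuousOn_arc {f : ℍ → ℂ} (hf : IsWeaklyHolomorphicModularFunction f) :
    ContinuousOn (fun t : ℝ => f (arcPoint t)) (Set.Icc (Real.pi / 3) (2 * Real.pi / 3)) := by
  refine (differentiableOn_comp_ofComplex hf).continuousOn.comp (t := {z : ℂ | 0 < z.im})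
    (f := fun t : ℝ => Complex.exp (t * Complex.I)) (by fun_prop) ?_
  intro t ht
  rw [Set.mem_ofPred_eq, exp_mul_I_im]
  exact sin_pos_of_mem_arc ht

/-- The density of the arc integrals. -/
def arcDensity (f : ℍ → ℂ) (v u t : ℝ) : ℝ :=
  (f (arcPoint t)).re * Real.sin t * (arcKernel (Real.cos t) v + arcKernel (-Real.cos t) u)

/-- The contribution of one letter to the cycle integral: the real part of the integral of
`f(τ) (1 / (τ + u) - 1 / (τ - v)) dτ` along the arc from `e^{2πi/3}` to `e^{πi/3}`. -/
def arcIntegral (f : ℍ → ℂ) (v u : ℝ) : ℝ :=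
  ∫ t in (Real.pi / 3)..(2 * Real.pi / 3), arcDensity f v u t

theorem uIcc_arc : Set.uIcc (Real.pi / 3) (2 * Real.pi / 3)
    = Set.Icc (Real.pi / 3) (2 * Real.pi / 3) :=
  Set.uIcc_of_le (by linarith [Real.pi_pos])

theorem continuousOn_arcKernel {v : ℝ} (hv : 0 < v) {S : Set ℝ} {c : ℝ → ℝ}
    (hc : ContinuousOn c S) (h : ∀ t ∈ S, |c t| ≤ 1 / 2) :
    ContinuousOn (fun t => arcKernel (c t) v) S := by
  unfold arcKernel
  refine ContinuousOn.div continuousOn_const (by fun_prop) fun t ht => ?_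
  exact (lt_of_lt_of_le (by positivity) (arcKernel_denom_ge (h t ht) hv.le)).ne'

theorem continuousOn_arcDensity {f : ℍ → ℂ} (hf : IsWeaklyHolomorphicModularFunction f) {v u : ℝ}
    (hv : 0 < v) (hu : 0 < u) :
    ContinuousOn (arcDensity f v u) (Set.Icc (Real.pi / 3) (2 * Real.pi / 3)) := by
  have h1 := Complex.continuous_re.comp_continuousOn (continuousOn_arc hf)
  have h2 := continuousOn_arcKernel hv (S := Set.Icc (Real.pi / 3) (2 * Real.pi / 3))
    (c := fun t => Real.cos t) (by fun_prop) (fun t ht => abs_cos_le_of_mem_arc ht)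
  have h3 := continuousOn_arcKernel hu (S := Set.Icc (Real.pi / 3) (2 * Real.pi / 3))
    (c := fun t => -Real.cos t) (by fun_prop)
    (fun t ht => by rw [abs_neg]; exact abs_cos_le_of_mem_arc ht)
  exact (h1.mul (by fun_prop)).mul (h2.add h3)

theorem intervalIntegrable_arcDensity {f : ℍ → ℂ} (hf : IsWeaklyHolomorphicModularFunction f)
    {v u : ℝ} (hv : 0 < v) (hu : 0 < u) :
    IntervalIntegrable (arcDensity f v u) MeasureTheory.volume (Real.pi / 3) (2 * Real.pi / 3) := by
  apply ContinuousOn.intervalIntegrable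
  rw [uIcc_arc]
  exact continuousOn_arcDensity hf hv hu

theorem arcIntegral_inv (f : ℍ → ℂ) {v u : ℝ} (hv : 0 < v) (hu : 0 < u) :
    arcIntegral f v⁻¹ u⁻¹ = arcIntegral f v u := by
  simp only [arcIntegral, arcDensity, arcKernel_inv _ hv, arcKernel_inv _ hu]

/-- The arc integral is Lipschitz in the coordinates `v / (1 + v)` and `u / (1 + u)`. -/
theorem exists_abs_arcIntegral_sub_le {f : ℍ → ℂ} (hf : IsWeaklyHolomorphicModularFunction f) :
    ∃ C : ℝ, 0 ≤ C ∧ ∀ v u v' u' : ℝ, 0 < v → 0 < u → 0 < v' → 0 < u' →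
      |arcIntegral f v u - arcIntegral f v' u'| ≤
        C * (|v / (1 + v) - v' / (1 + v')| + |u / (1 + u) - u' / (1 + u')|) := by
  obtain ⟨B, hB⟩ := isCompact_Icc.exists_bound_of_continuousOn (continuousOn_arc hf)
  have hB0 : 0 ≤ B := (norm_nonneg _).trans (hB _ left_mem_arc)
  refine ⟨B * 16 * |2 * Real.pi / 3 - Real.pi / 3|, by positivity, ?_⟩
  intro v u v' u' hv hu hv' hu'
  rw [arcIntegral, arcIntegral, ← intervalIntegral.integral_sub
    (intervalIntegrable_arcDensity hf hv hu) (intervalIntegrable_arcDensity hf hv' hu')]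
  rw [mul_right_comm]
  refine (Real.norm_eq_abs _).symm.trans_le
    (intervalIntegral.norm_integral_le_of_norm_le_const ?_)
  intro t ht
  have ht' : t ∈ Set.Icc (Real.pi / 3) (2 * Real.pi / 3) := by
    rw [← uIcc_arc]; exact Set.uIoc_subset_uIcc ht
  have hc := abs_cos_le_of_mem_arc ht'
  have h1 := abs_arcKernel_sub_le hc hv hv'
  have h2 := abs_arcKernel_sub_le (c := -Real.cos t) (by rwa [abs_neg]) hu hu'
  have e : arcDensity f v u t - arcDensity f v' u' t = (f (arcPoint t)).re * Real.sin t *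
      ((arcKernel (Real.cos t) v - arcKernel (Real.cos t) v') +
        (arcKernel (-Real.cos t) u - arcKernel (-Real.cos t) u')) := by
    unfold arcDensity; ring
  rw [e, Real.norm_eq_abs, abs_mul, abs_mul]
  have h3 : |(f (arcPoint t)).re| ≤ B := (Complex.abs_re_le_norm _).trans (hB t ht')
  have h4 : |(f (arcPoint t)).re| * |Real.sin t| ≤ B * 1 :=
    mul_le_mul h3 (Real.abs_sin_le_one t) (abs_nonneg _) hB0
  calc _ ≤ (B * 1) * (16 * |v / (1 + v) - v' / (1 + v')| + 16 * |u / (1 + u) - u' / (1 + u')|) :=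
        mul_le_mul h4 ((abs_add_le _ _).trans (add_le_add h1 h2)) (abs_nonneg _) (by linarith)
    _ = _ := by ring

/-- The arc integral of a nonzero function which is non-negative on the arc is positive. -/
theorem arcIntegral_pos {f : ℍ → ℂ} (hf : IsWeaklyHolomorphicModularFunction f) (hf0 : f ≠ 0)
    (hpos : IsNonnegOnArc f) {v u : ℝ} (hv : 0 < v) (hu : 0 < u) : 0 < arcIntegral f v u := by
  have hlt : Real.pi / 3 < 2 * Real.pi / 3 := by linarith [Real.pi_pos]
  have hK : ∀ t ∈ Set.Icc (Real.pi / 3) (2 * Real.pi / 3),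
      0 < Real.sin t * (arcKernel (Real.cos t) v + arcKernel (-Real.cos t) u) := fun t ht =>
    mul_pos (sin_pos_of_mem_arc ht) (add_pos (arcKernel_pos (abs_cos_le_of_mem_arc ht) hv)
      (arcKernel_pos (by rw [abs_neg]; exact abs_cos_le_of_mem_arc ht) hu))
  refine intervalIntegral.integral_pos hlt (continuousOn_arcDensity hf hv hu) ?_ ?_
  · intro t ht
    have ht' := Set.Ioc_subset_Icc_self ht
    rw [arcDensity, mul_assoc]
    exact mul_nonneg (hpos t ht').2 (hK t ht').le
  -- If the density is nowhere positive, then `f` vanishes on the arc, and the identity theorem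
  -- forces `f = 0`.
  · by_contra! hcon
    apply hf0
    have hz : ∀ t ∈ Set.Icc (Real.pi / 3) (2 * Real.pi / 3), f (arcPoint t) = 0 := by
      intro t ht
      have h1 := hcon t ht
      rw [arcDensity, mul_assoc] at h1
      have h2 : (f (arcPoint t)).re ≤ 0 := by
        by_contra! h
        exact absurd (mul_pos h (hK t ht)) h1.not_gt
      exact Complex.ext (le_antisymm h2 (hpos t ht).2) (hpos t ht).1
    have hUo : IsOpen {z : ℂ | 0 < z.im} := isOpen_lt continuous_const Complex.continuous_im
    have hUc : Convex ℝ {z : ℂ | 0 < z.im} := convex_halfSpace_im_gt 0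
    have han := (differentiableOn_comp_ofComplex hf).analyticOnNhd hUo
    have hmem : ∀ t ∈ Set.Icc (Real.pi / 3) (2 * Real.pi / 3),
        Complex.exp (t * Complex.I) ∈ {z : ℂ | 0 < z.im} := by
      intro t ht
      rw [Set.mem_ofPred_eq, exp_mul_I_im]
      exact sin_pos_of_mem_arc ht
    have hfreq : ∃ᶠ z in 𝓝[≠] (Complex.exp ((Real.pi / 3 : ℝ) * Complex.I)),
        f (UpperHalfPlane.ofComplex z) = 0 := by
      have htend : Filter.Tendsto (fun t : ℝ => Complex.exp (t * Complex.I))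
          (𝓝[>] (Real.pi / 3)) (𝓝[≠] (Complex.exp ((Real.pi / 3 : ℝ) * Complex.I))) := by
        apply tendsto_nhdsWithin_of_tendsto_nhds_of_eventually_within
        · exact (Continuous.tendsto (by fun_prop) _).mono_left nhdsWithin_le_nhds
        -- The cosine is strictly decreasing here, so the approximating points of the arc differ
        -- from its endpoint.
        · filter_upwards [Ioo_mem_nhdsGT hlt] with t ht h
          have h' := congrArg Complex.re h
          rw [Complex.exp_ofReal_mul_I_re, Complex.exp_ofReal_mul_I_re] at h'
          have := Real.cos_lt_cos_of_nonneg_of_le_pi (x := Real.pi / 3) (y := t)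
            (by positivity) (by linarith [ht.2, Real.pi_pos]) ht.1
          linarith
      refine htend.frequently (Filter.Eventually.frequently ?_)
      filter_upwards [Ioo_mem_nhdsGT hlt] with t ht
      exact hz t ⟨ht.1.le, ht.2.le⟩
    have hzero := han.eqOn_zero_of_preconnected_of_frequently_eq_zero hUc.isPreconnected
      (hmem _ left_mem_arc) hfreq
    funext τ
    have := hzero τ.im_pos
    simpa using this

/-! ### The cycle integral as a sum over letters -/

/-- Since the determinant is `1`, the discriminant equals `(A 0 0 - A 1 1)² + 4 * A 0 1 * A 1 0`. -/
theorem isHyperbolic_of_off_diag_pos {A : SL(2, ℤ)} (h : 0 < A 0 1 ∧ 0 < A 1 0) :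
    A.1.IsHyperbolic := by
  have hdet := det_two A
  rw [Matrix.IsHyperbolic, Matrix.discr_fin_two, A.2, Matrix.trace_fin_two]
  change 0 < (A 0 0 + A 1 1) ^ 2 - 4 * 1
  nlinarith [mul_pos h.1 h.2, sq_nonneg (A 0 0 - A 1 1)]

/-- The zeros of the form of a non-negative matrix with positive off-diagonal entries are its
positive fixed point and minus the positive fixed point of the reversed matrix. -/
theorem exists_fixed_points {A : SL(2, ℤ)} (hA : IsFareyMatrix A) (h : 0 < A 0 1 ∧ 0 < A 1 0) :
    ∃ v u : ℝ, 0 < v ∧ 0 < u ∧ mob A v = v ∧ mob (rev A) u = u ∧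
      ∀ z : ℂ, (Real.sqrt (formD A) : ℂ) * ((z + u) * (z - v)) =
        (-u - v) * ((formA A : ℂ) * z ^ 2 + (formB A : ℂ) * z + (formC A : ℂ)) := by
  have hyp := isHyperbolic_of_off_diag_pos h
  obtain ⟨hg, hσ, ha, hb, hc, hr, -⟩ := form_rel A hyp
  obtain ⟨-, hD, w, w', -, -, hw, hw', hs⟩ := form_spec A hyp
  have htr : A.1.trace.sign = 1 := by
    apply Int.sign_eq_one_of_pos
    rw [Matrix.trace_fin_two]
    exact add_pos (by linarith [hA.p]) (by linarith [hA.s])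
  rw [htr] at ha hb hc
  have hgR : (0 : ℝ) < fixedPointGcd A := by exact_mod_cast hg
  have ha' : (A 1 0 : ℝ) = -(1 * fixedPointGcd A) * formA A := by exact_mod_cast ha
  have hb' : (A 1 1 : ℝ) - A 0 0 = -(1 * fixedPointGcd A) * formB A := by exact_mod_cast hb
  have hc' : -(A 0 1 : ℝ) = -(1 * fixedPointGcd A) * formC A := by exact_mod_cast hc
  have hqR : (0 : ℝ) < A 0 1 := by exact_mod_cast h.1
  have hrR : (0 : ℝ) < A 1 0 := by exact_mod_cast h.2
  have hDR : (formD A : ℝ) = (formB A : ℝ) ^ 2 - 4 * formA A * formC A := by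
    rw [formD]; push_cast; ring
  have hDpos : (0 : ℝ) < formD A := by exact_mod_cast hD
  -- The trace is positive, so `A 1 0 = -g a` and `A 0 1 = g c` with `g > 0`, whence `a < 0 < c`.
  -- The zeros then have opposite signs, and the normalization of `Q` makes the attracting one `w'`
  -- the positive one.
  have haneg : (formA A : ℝ) < 0 := by
    by_contra! hcon
    have : 0 ≤ (fixedPointGcd A : ℝ) * formA A := by positivity
    linarith
  have hcpos : (0 : ℝ) < formC A := by
    by_contra! hcon
    have : (fixedPointGcd A : ℝ) * formC A ≤ 0 := mul_nonpos_of_nonneg_of_nonpos hgR.le hcon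
    linarith
  have hww : w < w' := by
    rw [sign_neg haneg] at hs
    have := sign_eq_neg_one_iff.1 hs.symm
    linarith
  have hB : (formB A : ℝ) = -formA A * (w + w') := by
    have : (w - w') * (formA A * (w + w') + formB A) = 0 := by linear_combination hw - hw'
    rcases mul_eq_zero.1 this with h | h <;> linarith
  have hC : (formC A : ℝ) = formA A * (w * w') := by
    rw [hB] at hw; linear_combination hw
  have hprod : w * w' < 0 := by
    by_contra! hcon
    have := mul_nonpos_of_nonpos_of_nonneg haneg.le hcon
    linarith
  have hwneg : w < 0 := by
    by_contra! hcon
    exact absurd (mul_nonneg hcon (hcon.trans hww.le)) hprod.not_ge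
  have hwpos : 0 < w' := by
    by_contra! hcon
    exact absurd (mul_nonneg_of_nonpos_of_nonpos hwneg.le hcon) hprod.not_ge
  -- By the same normalization no absolute value is needed, which fixes the sign of the partial
  -- fractions.
  have hsqrt : Real.sqrt (formD A) = formA A * (w - w') := by
    rw [hDR, hB, hC, show (-(formA A : ℝ) * (w + w')) ^ 2 - 4 * formA A * (formA A * (w * w'))
      = (formA A * (w - w')) ^ 2 by ring, Real.sqrt_sq]
    exact mul_nonneg_of_nonpos_of_nonpos haneg.le (by linarith)
  refine ⟨w', -w, hwpos, by linarith, ?_, ?_, ?_⟩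
  · rw [mob, div_eq_iff (hA.denom_pos hwpos).ne']
    linear_combination fixedPointGcd A * hw' - w' ^ 2 * ha' - w' * hb' - hc'
  · rw [mob, div_eq_iff (hA.rev.denom_pos (by linarith)).ne']
    simp only [rev_00, rev_01, rev_10, rev_11]
    linear_combination fixedPointGcd A * hw - w ^ 2 * ha' - w * hb' - hc'
  · intro z
    have hBC : (formB A : ℂ) = -formA A * (w + w') := by exact_mod_cast hB
    have hCC : (formC A : ℂ) = formA A * (w * w') := by exact_mod_cast hC
    rw [hsqrt, hBC, hCC]
    push_cast
    ring

/-- The cycle integrand has a primitive. -/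
theorem exists_primitive {f : ℍ → ℂ} (hf : IsWeaklyHolomorphicModularFunction f)
    {A : SL(2, ℤ)} (hA : A.1.IsHyperbolic)
    (hQ : ∀ z : ℂ, 0 < z.im →
      (formA A : ℂ) * z ^ 2 + (formB A : ℂ) * z + (formC A : ℂ) ≠ 0) :
    ∃ G : ℂ → ℂ, (∀ z : ℂ, 0 < z.im → HasDerivAt G (cycleIntegrand f A z) z) ∧
      ∀ τ : ℍ, cycleIntegralFrom f A τ = G (A • τ : ℍ) - G τ := by
  have hUo : IsOpen {z : ℂ | 0 < z.im} := isOpen_lt continuous_const Complex.continuous_im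
  have hUc : Convex ℝ {z : ℂ | 0 < z.im} := convex_halfSpace_im_gt 0
  have hfd : DifferentiableOn ℂ (cycleIntegrand f A) {z | 0 < z.im} := by
    unfold cycleIntegrand
    exact ((differentiableOn_comp_ofComplex hf).mul_const _).div (by fun_prop) hQ
  obtain ⟨G, hG'⟩ := hUc.exists_forall_hasDerivWithinAt hfd
  have hG : ∀ z : ℂ, 0 < z.im → HasDerivAt G (cycleIntegrand f A z) z :=
    fun z hz => (hG' z hz).hasDerivAt (hUo.mem_nhds hz)
  refine ⟨G, hG, fun τ => ?_⟩
  rw [cycleIntegralFrom, if_pos hA]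
  have hmem : ∀ t ∈ Set.uIcc (0 : ℝ) 1,
      (τ : ℂ) + (t : ℂ) * (((A • τ : ℍ) : ℂ) - τ) ∈ {z : ℂ | 0 < z.im} := by
    intro t ht
    rw [Set.uIcc_of_le zero_le_one] at ht
    have := hUc.add_smul_sub_mem τ.im_pos (A • τ).im_pos ht
    simpa using this
  have h := intervalIntegral.integral_eq_sub_of_hasDerivAt (a := (0 : ℝ)) (b := 1)
    (f := fun t : ℝ => G ((τ : ℂ) + (t : ℂ) * (((A • τ : ℍ) : ℂ) - τ)))
    (f' := fun t : ℝ => cycleIntegrand f A ((τ : ℂ) + (t : ℂ) * (((A • τ : ℍ) : ℂ) - τ))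
      * (((A • τ : ℍ) : ℂ) - τ)) ?_ ?_
  · rw [h]; simp
  · intro t ht
    have h1 : HasDerivAt (fun t : ℝ => (τ : ℂ) + (t : ℂ) * (((A • τ : ℍ) : ℂ) - τ))
        (((A • τ : ℍ) : ℂ) - τ) t := by
      simpa using ((Complex.ofRealCLM.hasDerivAt (x := t)).mul_const
        (((A • τ : ℍ) : ℂ) - τ)).const_add (τ : ℂ)
    exact (hG _ (hmem t ht)).comp t h1
  · apply ContinuousOn.intervalIntegrable
    refine ContinuousOn.mul ?_ continuousOn_const
    exact hfd.continuousOn.comp (by fun_prop) hmem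

/-- The pull back of `dτ / (τ + ũ) - dτ / (τ - ṽ)` under a Möbius transformation. -/
theorem mobius_pullback {p q r s z u v : ℂ} (hdet : p * s - q * r = 1) (hz : r * z + s ≠ 0)
    (hv : r * v + s ≠ 0) (hu : r * u + p ≠ 0)
    (hzu : z + (s * u + q) / (r * u + p) ≠ 0) (hzv : z - v ≠ 0) :
    (-u - (p * v + q) / (r * v + s)) /
        (((p * z + q) / (r * z + s) + u) * ((p * z + q) / (r * z + s) - (p * v + q) / (r * v + s)))
        * (1 / (r * z + s) ^ 2)
      = (-((s * u + q) / (r * u + p)) - v) / ((z + (s * u + q) / (r * u + p)) * (z - v)) := by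
  set x := (s * u + q) / (r * u + p) with hx
  have hxe : x * (r * u + p) = s * u + q := div_mul_cancel₀ _ hu
  -- Each of the three differences is the corresponding difference before the action times
  -- automorphy factors, which cancel in the quotient.
  have e1 : (p * z + q) / (r * z + s) + u = (r * u + p) * (z + x) / (r * z + s) := by
    rw [eq_div_iff hz, add_mul, div_mul_cancel₀ _ hz]
    linear_combination -hxe
  have e2 : (p * z + q) / (r * z + s) - (p * v + q) / (r * v + s)
      = (z - v) / ((r * z + s) * (r * v + s)) := by
    rw [div_sub_div _ _ hz hv]
    congr 1
    linear_combination (z - v) * hdet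
  have e3 : -u - (p * v + q) / (r * v + s) = (r * u + p) * (-x - v) / (r * v + s) := by
    rw [eq_div_iff hv, sub_mul, div_mul_cancel₀ _ hv]
    linear_combination hxe
  rw [e1, e2, e3]
  field_simp

/-- The real part of `(1 / (z + u) - 1 / (z - v)) i z` on the unit circle. -/
theorem re_form_on_circle (t u v : ℝ)
    (hzu : Complex.exp (t * Complex.I) + u ≠ 0) (hzv : Complex.exp (t * Complex.I) - v ≠ 0) :
    (((-u - v) / ((Complex.exp (t * Complex.I) + u) * (Complex.exp (t * Complex.I) - v)) *
      (Complex.exp (t * Complex.I) * Complex.I) : ℂ)).re =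
      -(Real.sin t * (arcKernel (Real.cos t) v + arcKernel (-Real.cos t) u)) := by
  -- Partial fractions; the real part of `i` times a number is minus its imaginary part.
  have e : ((-u - v) / ((Complex.exp (t * Complex.I) + u) * (Complex.exp (t * Complex.I) - v)) *
      (Complex.exp (t * Complex.I) * Complex.I) : ℂ) =
      (Complex.exp (t * Complex.I) / (Complex.exp (t * Complex.I) + u)
        - Complex.exp (t * Complex.I) / (Complex.exp (t * Complex.I) - v)) * Complex.I := by
    field_simp
    ring
  rw [e, Complex.mul_I_re, Complex.sub_im, Complex.div_im, Complex.div_im]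
  have hcs := Real.sin_sq_add_cos_sq t
  have n1 : Complex.normSq (Complex.exp (t * Complex.I) + u) = u ^ 2 - 2 * (-Real.cos t) * u + 1 := by
    rw [Complex.normSq_apply]
    simp only [Complex.add_re, Complex.add_im, Complex.exp_ofReal_mul_I_re,
      Complex.exp_ofReal_mul_I_im, Complex.ofReal_re, Complex.ofReal_im]
    linear_combination hcs
  have n2 : Complex.normSq (Complex.exp (t * Complex.I) - v) = v ^ 2 - 2 * Real.cos t * v + 1 := by
    rw [Complex.normSq_apply]
    simp only [Complex.sub_re, Complex.sub_im, Complex.exp_ofReal_mul_I_re,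
      Complex.exp_ofReal_mul_I_im, Complex.ofReal_re, Complex.ofReal_im]
    linear_combination hcs
  rw [n1, n2]
  simp only [Complex.add_re, Complex.add_im, Complex.sub_re, Complex.sub_im,
    Complex.exp_ofReal_mul_I_re, Complex.exp_ofReal_mul_I_im, Complex.ofReal_re,
    Complex.ofReal_im, arcKernel]
  ring

/-- The part of the cycle integral between `M ω` and `M L ω`, for a letter `L`. -/
theorem re_primitive_sub {f : ℍ → ℂ} (hf : IsWeaklyHolomorphicModularFunction f)
    (hpos : IsNonnegOnArc f) {A M : SL(2, ℤ)} (hM : IsFareyMatrix M) {G : ℂ → ℂ}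
    (hG : ∀ z : ℂ, 0 < z.im → HasDerivAt G (cycleIntegrand f A z) z) {u v : ℝ} (hu : 0 < u)
    (hv : 0 < v)
    (hQ : ∀ z : ℂ, 0 < z.im → cycleIntegrand f A z =
      f (UpperHalfPlane.ofComplex z) * ((-u - (mob M v : ℝ)) / ((z + u) * (z - (mob M v : ℝ))))) :
    (G (M • arcPoint (Real.pi / 3) : ℍ)).re - (G (M • arcPoint (2 * Real.pi / 3) : ℍ)).re
      = arcIntegral f v (mob (rev M) u) := by
  have hu' := hM.rev.mob_pos hu
  have hdet : (M 0 0 : ℂ) * M 1 1 - M 0 1 * M 1 0 = 1 := by exact_mod_cast det_two M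
  have hne : ∀ (z : ℂ) (x : ℝ), 0 < z.im → z + x ≠ 0 := by
    intro z x hz h
    have := congrArg Complex.im h
    simp at this
    exact hz.ne' this
  let m : ℂ → ℂ := fun z => ((M 0 0 : ℂ) * z + M 0 1) / ((M 1 0 : ℂ) * z + M 1 1)
  have hm : ∀ τ : ℍ, ((M • τ : ℍ) : ℂ) = m τ := by
    intro τ
    rw [UpperHalfPlane.coe_specialLinearGroup_apply]
    simp [m]
  have hden : ∀ z : ℂ, 0 < z.im → (M 1 0 : ℂ) * z + M 1 1 ≠ 0 := by
    intro z hz h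
    have h1 := congrArg Complex.im h
    have h2 := congrArg Complex.re h
    simp at h1 h2
    have hs := hM.s
    rcases h1 with h1 | h1
    · rw [h1] at h2
      simp at h2
      omega
    · exact hz.ne' h1
  -- The primitive is differentiated along the translated arc. The minus sign accounts for the
  -- orientation from `2π/3` down to `π/3`.
  have hderiv : ∀ t ∈ Set.uIcc (Real.pi / 3) (2 * Real.pi / 3),
      HasDerivAt (fun t : ℝ => -(G (m (Complex.exp (t * Complex.I)))).re)
        (arcDensity f v (mob (rev M) u) t) t := by
    intro t ht
    rw [uIcc_arc] at ht
    have hτ := coe_arcPoint ht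
    have hzim : 0 < (Complex.exp (t * Complex.I)).im := by
      rw [exp_mul_I_im]; exact sin_pos_of_mem_arc ht
    have hd := hden _ hzim
    have hmim : 0 < (m (Complex.exp (t * Complex.I))).im := by
      rw [← hτ, ← hm]; exact (M • arcPoint t).im_pos
    have h1 : HasDerivAt (fun z : ℂ => (M 0 0 : ℂ) * z + M 0 1) (M 0 0 : ℂ)
        (Complex.exp (t * Complex.I)) := by
      simpa using ((hasDerivAt_id (Complex.exp (t * Complex.I))).const_mul
        (M 0 0 : ℂ)).add_const (M 0 1 : ℂ)
    have h2 : HasDerivAt (fun z : ℂ => (M 1 0 : ℂ) * z + M 1 1) (M 1 0 : ℂ)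
        (Complex.exp (t * Complex.I)) := by
      simpa using ((hasDerivAt_id (Complex.exp (t * Complex.I))).const_mul
        (M 1 0 : ℂ)).add_const (M 1 1 : ℂ)
    have h3 : HasDerivAt m (1 / ((M 1 0 : ℂ) * Complex.exp (t * Complex.I) + M 1 1) ^ 2)
        (Complex.exp (t * Complex.I)) := by
      have e : (M 0 0 : ℂ) * ((M 1 0 : ℂ) * Complex.exp (t * Complex.I) + M 1 1)
          - ((M 0 0 : ℂ) * Complex.exp (t * Complex.I) + M 0 1) * M 1 0 = 1 := by
        linear_combination hdet
      rw [← e]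
      exact h1.div h2 hd
    have h4 : HasDerivAt (fun t : ℝ => Complex.exp (t * Complex.I))
        (Complex.exp (t * Complex.I) * Complex.I) t := by
      have h := (Complex.ofRealCLM.hasDerivAt (x := t)).mul_const Complex.I
      simpa using h.cexp
    have h5 := (((hG _ hmim).comp _ h3).comp t h4)
    have h6 := (Complex.reCLM.hasFDerivAt.comp_hasDerivAt t h5).neg
    -- By invariance the value of `f` is that on the arc itself, a real number, which can be taken
    -- out of the real part.
    have hf1 : f (UpperHalfPlane.ofComplex (m (Complex.exp (t * Complex.I))))
        = ((f (arcPoint t)).re : ℂ) := by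
      rw [← hτ, ← hm, UpperHalfPlane.ofComplex_apply, hf.invariant]
      exact Complex.ext rfl (hpos t ht).1
    refine HasDerivAt.congr_deriv (f := fun t : ℝ => -(G (m (Complex.exp (t * Complex.I)))).re)
      h6 ?_
    have hMv : ((mob M v : ℝ) : ℂ) = ((M 0 0 : ℂ) * v + M 0 1) / ((M 1 0 : ℂ) * v + M 1 1) := by
      rw [mob]; push_cast; rfl
    have hMu : ((mob (rev M) u : ℝ) : ℂ) = ((M 1 1 : ℂ) * u + M 0 1) / ((M 1 0 : ℂ) * u + M 0 0) := by
      rw [mob]; push_cast; rfl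
    have hvd : (M 1 0 : ℂ) * v + M 1 1 ≠ 0 := by exact_mod_cast (hM.denom_pos hv).ne'
    have hud : (M 1 0 : ℂ) * u + M 0 0 ≠ 0 := by exact_mod_cast (hM.rev.denom_pos hu).ne'
    have hzu := hne _ (mob (rev M) u) hzim
    have hzv : Complex.exp (t * Complex.I) - v ≠ 0 := by
      have := hne _ (-v) hzim
      rwa [Complex.ofReal_neg, ← sub_eq_add_neg] at this
    have hpull := mobius_pullback hdet hd hvd hud (by rw [← hMu]; exact hzu) hzv
    rw [← hMu, ← hMv] at hpull
    rw [hQ _ hmim, hf1, mul_assoc, mul_assoc, ← mul_assoc _ (1 / _), hpull]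
    change -((_ : ℂ).re) = _
    rw [Complex.re_ofReal_mul, re_form_on_circle t _ _ hzu hzv, arcDensity]
    ring
  have hint := intervalIntegral.integral_eq_sub_of_hasDerivAt hderiv
    (intervalIntegrable_arcDensity hf hv hu')
  rw [hm, hm, coe_arcPoint left_mem_arc, coe_arcPoint right_mem_arc, arcIntegral, hint]
  ring

/-- The real part of the cycle integral of a word in `T` and `V` is the sum of the arc integrals
at the fixed points of its cyclic rotations. -/
theorem re_cycleIntegral_fareyMatrix {f : ℍ → ℂ} (hf : IsWeaklyHolomorphicModularFunction f)
    (hpos : IsNonnegOnArc f) (x : ℝ) (n : ℕ)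
    (h : 0 < fareyMatrix x n 0 1 ∧ 0 < fareyMatrix x n 1 0) {v u : ℝ} (hv : 0 < v) (hu : 0 < u)
    (hfv : mob (fareyMatrix x n) v = v) (hfu : mob (rev (fareyMatrix x n)) u = u) :
    (cycleIntegral f (fareyMatrix x n)).re = ∑ k ∈ Finset.range n,
      arcIntegral f (mob (fareyMatrix (fareyMap^[k] x) (n - k)) v)
        (mob (rev (fareyMatrix x k)) u) := by
  have hA := isFareyMatrix_fareyMatrix x n
  obtain ⟨v', u', hv', hu', hfv', hfu', hform⟩ := exists_fixed_points hA h
  obtain rfl := mob_fixed_unique hA h.1 hv hv' hfv hfv'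
  obtain rfl := mob_fixed_unique hA.rev h.1 hu hu' hfu hfu'
  have hne : ∀ (z : ℂ) (x : ℝ), 0 < z.im → z + x ≠ 0 := by
    intro z x hz h
    have := congrArg Complex.im h
    simp at this
    exact hz.ne' this
  have hyp := isHyperbolic_of_off_diag_pos h
  obtain ⟨-, hD, -⟩ := form_spec _ hyp
  have hS : (Real.sqrt (formD (fareyMatrix x n)) : ℂ) ≠ 0 := by
    rw [Complex.ofReal_ne_zero]
    exact (Real.sqrt_pos.2 (by exact_mod_cast hD)).ne'
  have hz2 : ∀ z : ℂ, 0 < z.im → (z + u) * (z - v) ≠ 0 := by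
    intro z hz
    have := hne z (-v) hz
    rw [Complex.ofReal_neg, ← sub_eq_add_neg] at this
    exact mul_ne_zero (hne z u hz) this
  have hQ : ∀ z : ℂ, 0 < z.im → (formA (fareyMatrix x n) : ℂ) * z ^ 2
      + (formB (fareyMatrix x n) : ℂ) * z + (formC (fareyMatrix x n) : ℂ) ≠ 0 := by
    intro z hz h0
    have := hform z
    rw [h0, mul_zero] at this
    exact mul_ne_zero hS (hz2 z hz) this
  obtain ⟨G, hG, hGI⟩ := exists_primitive hf hyp hQ
  have hF : ∀ z : ℂ, 0 < z.im → cycleIntegrand f (fareyMatrix x n) z =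
      f (UpperHalfPlane.ofComplex z) * ((-u - v) / ((z + u) * (z - v))) := by
    intro z hz
    rw [cycleIntegrand, mul_div_assoc]
    congr 1
    rw [div_eq_div_iff (hQ z hz) (hz2 z hz), hform z]
  -- With base point `ω` the integral telescopes over the points `A_k ω`.
  rw [← cycleIntegralFrom_eq hf _ (arcPoint (2 * Real.pi / 3)), hGI, Complex.sub_re]
  have htel := Finset.sum_range_sub
    (fun k => (G (fareyMatrix x k • arcPoint (2 * Real.pi / 3) : ℍ)).re) n
  have h0 : fareyMatrix x 0 = 1 := rfl
  simp only [h0, one_smul] at htel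
  rw [← htel]
  refine Finset.sum_congr rfl fun k hk => ?_
  have hkn : k + (n - k) = n := Nat.add_sub_cancel' (Finset.mem_range.1 hk).le
  have hMk := isFareyMatrix_fareyMatrix x k
  have hR := isFareyMatrix_fareyMatrix (fareyMap^[k] x) (n - k)
  have hvk : mob (fareyMatrix x k) (mob (fareyMatrix (fareyMap^[k] x) (n - k)) v) = v := by
    rw [← mob_mul hMk hR hv, ← fareyMatrix_add, hkn, hfv]
  have hstep : fareyMatrix x (k + 1) = fareyMatrix x k * fareyLetter (fareyMap^[k] x) := by
    rw [fareyMatrix_add, fareyMatrix_succ']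
    simp [fareyMatrix]
  rw [hstep, mul_smul, letter_smul_arcPoint]
  exact re_primitive_sub hf hpos hMk hG hu (hR.mob_pos hv) (by rw [hvk]; exact hF)

/-! ### Asymptotics along an eventually periodic Farey path -/

/-- The deviation of the partial sums from linear growth is itself periodic, hence bounded by the
sum of its absolute values over one period. -/
theorem sum_range_periodic {e : ℕ → ℝ} {p : ℕ} (hp : 0 < p) (he : ∀ n, e (n + p) = e n) :
    ∃ K : ℝ, ∀ n : ℕ,
      |∑ k ∈ Finset.range n, e k - n * ((∑ k ∈ Finset.range p, e k) / p)| ≤ K := by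
  have hpR : (p : ℝ) ≠ 0 := by exact_mod_cast hp.ne'
  set D : ℕ → ℝ := fun n => ∑ k ∈ Finset.range n, e k - n * ((∑ k ∈ Finset.range p, e k) / p)
    with hD
  have hper : Function.Periodic D p := by
    intro n
    simp only [hD]
    rw [add_comm n p, Finset.sum_range_add]
    have : ∀ k, e (p + k) = e k := fun k => by rw [add_comm, he]
    simp only [this]
    push_cast
    field_simp
    ring
  refine ⟨∑ i ∈ Finset.range p, |D i|, fun n => ?_⟩
  change |D n| ≤ _
  rw [← hper.map_mod_nat n]
  exact Finset.single_le_sum (f := fun i => |D i|) (fun _ _ => abs_nonneg _)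
    (Finset.mem_range.2 (Nat.mod_lt _ hp))

theorem exists_abs_arcIntegral_le {f : ℍ → ℂ} (hf : IsWeaklyHolomorphicModularFunction f) :
    ∃ K : ℝ, ∀ v u : ℝ, 0 < v → 0 < u → |arcIntegral f v u| ≤ K := by
  obtain ⟨C, hC, h⟩ := exists_abs_arcIntegral_sub_le hf
  refine ⟨|arcIntegral f 1 1| + C * (1 + 1), fun v u hv hu => ?_⟩
  have h1 := h v u 1 1 hv hu one_pos one_pos
  have h2 : ∀ v : ℝ, 0 < v → |v / (1 + v) - 1 / (1 + 1)| ≤ 1 := by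
    intro v hv
    have h3 : 0 < v / (1 + v) := by positivity
    have h4 : v / (1 + v) < 1 := by rw [div_lt_one (by positivity)]; linarith
    exact abs_le.2 ⟨by linarith, by linarith⟩
  have h3 : C * (|v / (1 + v) - 1 / (1 + 1)| + |u / (1 + u) - 1 / (1 + 1)|) ≤ C * (1 + 1) :=
    mul_le_mul_of_nonneg_left (add_le_add (h2 v hv) (h2 u hu)) hC
  have h4 := abs_sub_abs_le_abs_sub (arcIntegral f v u) (arcIntegral f 1 1)
  linarith

/-- The cycle integral of a period of a Farey path, as a sum along the orbit. -/
theorem re_cycleIntegral_period {f : ℍ → ℂ} (hf : IsWeaklyHolomorphicModularFunction f)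
    (hpos : IsNonnegOnArc f) {z : ℝ} (hz : 0 < z) (hi : Irrational z) {p : ℕ}
    (hp : fareyMap^[p] z = z) (h : 0 < fareyMatrix z p 0 1 ∧ 0 < fareyMatrix z p 1 0) :
    ∃ u : ℝ, 0 < u ∧ mob (rev (fareyMatrix z p)) u = u ∧
      (cycleIntegral f (fareyMatrix z p)).re = ∑ k ∈ Finset.range p,
        arcIntegral f (fareyMap^[k] z) (mob (rev (fareyMatrix z k)) u) := by
  obtain ⟨-, u, -, hu, -, hfu, -⟩ := exists_fixed_points (isFareyMatrix_fareyMatrix z p) h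
  have hfz : mob (fareyMatrix z p) z = z := by
    have := mob_fareyMatrix_iterate hz hi p
    rwa [hp] at this
  refine ⟨u, hu, hfu, ?_⟩
  rw [re_cycleIntegral_fareyMatrix hf hpos z p h hz hu hfz hfu]
  refine Finset.sum_congr rfl fun k hk => ?_
  obtain ⟨h1, h2⟩ := fareyMap_iterate hz hi k
  -- The rest of the period, applied to `z`, gives back the `k`-th point of the orbit.
  have := mob_fareyMatrix_iterate h1 h2 (p - k)
  rw [← Function.iterate_add_apply, Nat.sub_add_cancel (Finset.mem_range.1 hk).le, hp] at this
  rw [this]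

theorem re_cycleIntegral_period_pos {f : ℍ → ℂ} (hf : IsWeaklyHolomorphicModularFunction f)
    (hf0 : f ≠ 0) (hpos : IsNonnegOnArc f) {z : ℝ} (hz : 0 < z) (hi : Irrational z) {p : ℕ}
    (hp0 : 0 < p) (hp : fareyMap^[p] z = z)
    (h : 0 < fareyMatrix z p 0 1 ∧ 0 < fareyMatrix z p 1 0) :
    0 < (cycleIntegral f (fareyMatrix z p)).re := by
  obtain ⟨u, hu, -, e⟩ := re_cycleIntegral_period hf hpos hz hi hp h
  rw [e]
  exact Finset.sum_pos (fun k _ => arcIntegral_pos hf hf0 hpos (fareyMap_iterate hz hi k).1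
    ((isFareyMatrix_fareyMatrix z k).rev.mob_pos hu)) ⟨0, Finset.mem_range.2 hp0⟩

/-- Exchanging `T` and `V` does not change the real part of the cycle integral. -/
theorem re_cycleIntegral_inv {f : ℍ → ℂ} (hf : IsWeaklyHolomorphicModularFunction f)
    (hpos : IsNonnegOnArc f) {z : ℝ} (hz : 0 < z) (hi : Irrational z) {p : ℕ}
    (h : 0 < fareyMatrix z p 0 1 ∧ 0 < fareyMatrix z p 1 0) :
    (cycleIntegral f (fareyMatrix z⁻¹ p)).re = (cycleIntegral f (fareyMatrix z p)).re := by
  have hA := isFareyMatrix_fareyMatrix z p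
  obtain ⟨v, u, hv, hu, hfv, hfu, -⟩ := exists_fixed_points hA h
  have h' : 0 < fareyMatrix z⁻¹ p 0 1 ∧ 0 < fareyMatrix z⁻¹ p 1 0 := by
    rw [fareyMatrix_inv hz hi]; exact ⟨h.2, h.1⟩
  rw [re_cycleIntegral_fareyMatrix hf hpos z p h hv hu hfv hfu,
    re_cycleIntegral_fareyMatrix hf hpos z⁻¹ p h' (inv_pos.2 hv) (inv_pos.2 hu)
      (by rw [fareyMatrix_inv hz hi, mob_swap _ hv, hfv])
      (by rw [fareyMatrix_inv hz hi, rev_swap, mob_swap _ hu, hfu])]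
  refine Finset.sum_congr rfl fun k _ => ?_
  obtain ⟨h1, h2⟩ := fareyMap_iterate hz hi k
  rw [fareyMap_iterate_inv hz hi, fareyMatrix_inv h1 h2, fareyMatrix_inv hz hi, rev_swap,
    mob_swap _ hv, mob_swap _ hu]
  exact arcIntegral_inv f ((isFareyMatrix_fareyMatrix _ _).mob_pos hv)
    ((isFareyMatrix_fareyMatrix _ _).rev.mob_pos hu)

/-- Along an eventually periodic Farey path the cycle integral grows linearly, up to an error of
the size of a harmonic sum. -/
theorem exists_abs_re_cycleIntegral_sub_le {f : ℍ → ℂ}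
    (hf : IsWeaklyHolomorphicModularFunction f) (hpos : IsNonnegOnArc f) {x : ℝ} (hx : 0 < x)
    (hi : Irrational x) {s p : ℕ} (hp0 : 0 < p) (hp : fareyMap^[p] (fareyMap^[s] x) = fareyMap^[s] x)
    (h : 0 < fareyMatrix (fareyMap^[s] x) p 0 1 ∧ 0 < fareyMatrix (fareyMap^[s] x) p 1 0) :
    ∃ K C : ℝ, ∀ m : ℕ, p ≤ m →
      |(cycleIntegral f (fareyMatrix x (m + s))).re
          - m * ((cycleIntegral f (fareyMatrix (fareyMap^[s] x) p)).re / p)| ≤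
        K + C * ∑ j ∈ Finset.range m, 1 / ((j : ℝ) + 1) := by
  obtain ⟨hz, hzi⟩ := fareyMap_iterate hx hi s
  obtain ⟨u, hu, hfu, hS⟩ := re_cycleIntegral_period hf hpos hz hzi hp h
  generalize hzx : fareyMap^[s] x = z at *
  -- The periodic model: the true orbit of `z` replaces the rotated fixed points of the finite word,
  -- and `u` is the fixed point of the reversed period.
  set e : ℕ → ℝ := fun k => arcIntegral f (fareyMap^[k] z) (mob (rev (fareyMatrix z k)) u) with he
  have hper : ∀ n, e (n + p) = e n := by
    intro n
    simp only [he]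
    rw [Function.iterate_add_apply, hp, add_comm n p, fareyMatrix_add, hp, rev_mul,
      mob_mul (isFareyMatrix_fareyMatrix _ _).rev (isFareyMatrix_fareyMatrix _ _).rev hu, hfu]
  obtain ⟨K1, hK1⟩ := sum_range_periodic hp0 hper
  obtain ⟨K2, hK2⟩ := exists_abs_arcIntegral_le hf
  obtain ⟨C, hC, hLip⟩ := exists_abs_arcIntegral_sub_le hf
  refine ⟨K1 + s * K2, C * 2, fun m hm => ?_⟩
  rw [hS]
  have hAs := isFareyMatrix_fareyMatrix x s
  -- As `p ≤ m`, the word contains a complete period.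
  have hoff : 0 < fareyMatrix x (m + s) 0 1 ∧ 0 < fareyMatrix x (m + s) 1 0 := by
    rw [add_comm, fareyMatrix_add, hzx]
    refine hAs.off_diag_mul_left (isFareyMatrix_fareyMatrix z m) ?_
    rw [← Nat.add_sub_cancel' hm, fareyMatrix_add]
    exact (isFareyMatrix_fareyMatrix z p).off_diag_mul_right (isFareyMatrix_fareyMatrix _ _) h
  obtain ⟨v', u', hv', hu', hfv', hfu', -⟩ :=
    exists_fixed_points (isFareyMatrix_fareyMatrix x (m + s)) hoff
  rw [re_cycleIntegral_fareyMatrix hf hpos x (m + s) hoff hv' hu' hfv' hfu']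
  have hsplit := Finset.sum_range_add (fun k =>
      arcIntegral f (mob (fareyMatrix (fareyMap^[k] x) (m + s - k)) v')
        (mob (rev (fareyMatrix x k)) u')) s m
  rw [add_comm s m] at hsplit
  rw [hsplit]
  have hfirst : |∑ k ∈ Finset.range s,
      arcIntegral f (mob (fareyMatrix (fareyMap^[k] x) (m + s - k)) v')
        (mob (rev (fareyMatrix x k)) u')| ≤ s * K2 := by
    refine (Finset.abs_sum_le_sum_abs _ _).trans ?_
    refine (Finset.sum_le_card_nsmul _ _ K2 fun k _ => hK2 _ _
      ((isFareyMatrix_fareyMatrix _ _).mob_pos hv')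
      ((isFareyMatrix_fareyMatrix _ _).rev.mob_pos hu')).trans (le_of_eq ?_)
    simp
  -- After the letters common to both, the first arguments are images under the remaining `m - j`
  -- letters and the second ones images under `j` reversed letters, so contraction applies to both.
  -- The index `m - 1 - j`, one less than contraction allows, makes the first error the reflection
  -- of the second in the sum over `j`.
  have hterm : ∀ j ∈ Finset.range m,
      |arcIntegral f (mob (fareyMatrix (fareyMap^[s + j] x) (m + s - (s + j))) v')
        (mob (rev (fareyMatrix x (s + j))) u') - e j| ≤
      C * (1 / (((m - 1 - j : ℕ) : ℝ) + 1) + 1 / ((j : ℝ) + 1)) := by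
    intro j hj
    have hjm := Finset.mem_range.1 hj
    obtain ⟨h1, h2⟩ := fareyMap_iterate hz hzi j
    have hsub : m + s - (s + j) = m - j := by omega
    have hw := mob_fareyMatrix_iterate h1 h2 (m - j)
    have hu2 := hAs.rev.mob_pos hu'
    rw [hsub, add_comm s j, Function.iterate_add_apply, hzx, add_comm j s, fareyMatrix_add, hzx,
      rev_mul, mob_mul (isFareyMatrix_fareyMatrix z j).rev hAs.rev hu']
    have hMj := isFareyMatrix_fareyMatrix (fareyMap^[j] z) (m - j)
    have hRj := (isFareyMatrix_fareyMatrix z j).rev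
    have hw0 := (fareyMap_iterate h1 h2 (m - j)).1
    simp only [he]
    have key := (hLip _ _ _ _ (hMj.mob_pos hv') (hRj.mob_pos hu2) (hMj.mob_pos hw0)
      (hRj.mob_pos hu)).trans (mul_le_mul_of_nonneg_left (c := 1 / (((m - 1 - j : ℕ) : ℝ) + 1)
        + 1 / ((j : ℝ) + 1)) (add_le_add ?_ ?_) hC)
    · rwa [hw] at key
    · refine abs_mob_sub_mob_le hMj (le_trans ?_ (fareyMatrix_sum _ _)) hv' hw0
      omega
    · refine abs_mob_sub_mob_le hRj (le_trans (fareyMatrix_sum z j) ?_) hu2 hu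
      simp only [rev_00, rev_01, rev_10, rev_11]
      linarith
  have hsecond : |∑ j ∈ Finset.range m,
      arcIntegral f (mob (fareyMatrix (fareyMap^[s + j] x) (m + s - (s + j))) v')
        (mob (rev (fareyMatrix x (s + j))) u') - ∑ j ∈ Finset.range m, e j| ≤
      C * 2 * ∑ j ∈ Finset.range m, 1 / ((j : ℝ) + 1) := by
    rw [← Finset.sum_sub_distrib]
    refine (Finset.abs_sum_le_sum_abs _ _).trans ((Finset.sum_le_sum hterm).trans (le_of_eq ?_))
    rw [← Finset.mul_sum, Finset.sum_add_distrib,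
      Finset.sum_range_reflect (fun j : ℕ => 1 / ((j : ℝ) + 1)) m]
    ring
  have h3 := hK1 m
  rw [abs_le] at *
  constructor <;> linarith [hfirst.1, hfirst.2, hsecond.1, hsecond.2, h3.1, h3.2]

theorem tendsto_re_cycleIntegral_div {f : ℍ → ℂ} (hf : IsWeaklyHolomorphicModularFunction f)
    (hpos : IsNonnegOnArc f) {x : ℝ} (hx : 0 < x) (hi : Irrational x) {s p : ℕ} (hp0 : 0 < p)
    (hp : fareyMap^[p] (fareyMap^[s] x) = fareyMap^[s] x)
    (h : 0 < fareyMatrix (fareyMap^[s] x) p 0 1 ∧ 0 < fareyMatrix (fareyMap^[s] x) p 1 0) :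
    Filter.Tendsto (fun n : ℕ => (cycleIntegral f (fareyMatrix x n)).re / (n : ℝ)) Filter.atTop
      (𝓝 ((cycleIntegral f (fareyMatrix (fareyMap^[s] x) p)).re / p)) := by
  obtain ⟨K, C, hKC⟩ := exists_abs_re_cycleIntegral_sub_le hf hpos hx hi hp0 hp h
  generalize (cycleIntegral f (fareyMatrix (fareyMap^[s] x) p)).re / (p : ℝ) = L at *
  have hH : Filter.Tendsto
      (fun m : ℕ => (m : ℝ)⁻¹ * ∑ j ∈ Finset.range m, 1 / ((j : ℝ) + 1)) Filter.atTop (𝓝 0) :=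
    tendsto_one_div_add_atTop_nhds_zero_nat.cesaro
  have hb : Filter.Tendsto (fun m : ℕ => (m : ℝ)⁻¹ * K
      + C * ((m : ℝ)⁻¹ * ∑ j ∈ Finset.range m, 1 / ((j : ℝ) + 1))) Filter.atTop (𝓝 0) := by
    simpa using (tendsto_inv_atTop_nhds_zero_nat.mul_const K).add (hH.const_mul C)
  have h1 : Filter.Tendsto
      (fun m : ℕ => (cycleIntegral f (fareyMatrix x (m + s))).re / (m : ℝ)) Filter.atTop (𝓝 L) := by
    rw [tendsto_iff_dist_tendsto_zero]
    refine squeeze_zero' (Filter.Eventually.of_forall fun _ => dist_nonneg) ?_ hb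
    filter_upwards [Filter.eventually_ge_atTop p] with m hm
    have hm0 : (0 : ℝ) < m := by exact_mod_cast hp0.trans_le hm
    have e : (cycleIntegral f (fareyMatrix x (m + s))).re / (m : ℝ) - L
        = (m : ℝ)⁻¹ * ((cycleIntegral f (fareyMatrix x (m + s))).re - m * L) := by
      field_simp
    rw [Real.dist_eq, e, abs_mul, abs_of_pos (inv_pos.2 hm0)]
    calc _ ≤ (m : ℝ)⁻¹ * (K + C * ∑ j ∈ Finset.range m, 1 / ((j : ℝ) + 1)) :=
          mul_le_mul_of_nonneg_left (hKC m hm) (inv_pos.2 hm0).le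
      _ = _ := by ring
  rw [← Filter.tendsto_add_atTop_iff_nat s]
  -- The factor `m / (m + s)` replaces the denominator `m` by the full length `m + s`.
  have h2 := h1.mul (tendsto_natCast_div_add_atTop (s : ℝ))
  rw [mul_one] at h2
  refine h2.congr' ?_
  filter_upwards [Filter.eventually_ge_atTop 1] with m hm
  have hm0 : (0 : ℝ) < m := by exact_mod_cast hm
  have : (0 : ℝ) < m + s := by positivity
  push_cast
  field_simp

/-! ### Continued fractions and the Farey map -/

/-- The `n`-th complete quotient of `x`. -/
def completeQuotient (x : ℝ) (n : ℕ) : ℝ := (fun y : ℝ => (Int.fract y)⁻¹)^[n] x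

theorem completeQuotient_succ (x : ℝ) (n : ℕ) :
    completeQuotient x (n + 1) = (Int.fract (completeQuotient x n))⁻¹ :=
  Function.iterate_succ_apply' _ _ _

theorem completeQuotient_succ' (x : ℝ) (n : ℕ) :
    completeQuotient x (n + 1) = completeQuotient (Int.fract x)⁻¹ n :=
  Function.iterate_succ_apply _ _ _

namespace HasContFract

variable {x y : ℝ} {d : ℕ → ℤ}

theorem floor (h : HasContFract x d) : ⌊x⌋ = d 0 := by
  have := h.1
  rw [GenContFract.of_h_eq_floor] at this
  exact_mod_cast this

theorem irrational (h : HasContFract x d) : Irrational x := by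
  rintro ⟨q, hq⟩
  obtain ⟨n, hn⟩ := (GenContFract.terminates_iff_rat x).2 ⟨q, hq.symm⟩
  have : (GenContFract.of x).s.get? n = none := hn
  rw [h.2 n] at this
  exact absurd this (by simp)

theorem _root_.Irrational.fract_pos {x : ℝ} (h : Irrational x) : 0 < Int.fract x := by
  refine lt_of_le_of_ne (Int.fract_nonneg x) fun h0 => h.ne_int ⌊x⌋ ?_
  rw [← Int.floor_add_fract x, ← h0]
  simp

theorem tail (h : HasContFract x d) : HasContFract (Int.fract x)⁻¹ (fun n => d (n + 1)) := by
  have hfr : Int.fract x ≠ 0 := h.irrational.fract_pos.ne'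
  constructor
  · have h1 := GenContFract.of_s_head hfr
    have h2 : (GenContFract.of x).s.head = some ⟨1, (d (0 + 1) : ℝ)⟩ := h.2 0
    rw [h2] at h1
    rw [GenContFract.of_h_eq_floor]
    simp only [Option.some.injEq, GenContFract.Pair.mk.injEq, true_and] at h1
    exact h1.symm
  · intro n
    rw [← GenContFract.of_s_succ]
    exact h.2 (n + 1)

theorem completeQuotient (h : HasContFract x d) (n : ℕ) :
    HasContFract (completeQuotient x n) (fun i => d (i + n)) := by
  induction n with
  | zero => exact h
  | succ n ih =>
    rw [completeQuotient_succ]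
    have := ih.tail
    simpa only [Nat.add_assoc, Nat.add_comm 1 n] using this

/-- Both numbers are the limit of the same convergents. This yields periodicity of a Farey orbit
from periodicity of the partial quotients. -/
theorem unique (hx : HasContFract x d) (hy : HasContFract y d) : x = y := by
  have h1 : (GenContFract.of x).h = (GenContFract.of y).h := hx.1.trans hy.1.symm
  have h2 : (GenContFract.of x).s = (GenContFract.of y).s :=
    Stream'.Seq.ext fun n => (hx.2 n).trans (hy.2 n).symm
  have h3 : GenContFract.of x = GenContFract.of y := by
    cases hx' : GenContFract.of x
    cases hy' : GenContFract.of y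
    rw [hx', hy'] at h1 h2
    exact congrArg₂ GenContFract.mk h1 h2
  have h4 := GenContFract.of_convergence x
  rw [h3] at h4
  exact tendsto_nhds_unique h4 (GenContFract.of_convergence y)

end HasContFract

theorem one_lt_fract_inv {x : ℝ} (h : Irrational x) : 1 < (Int.fract x)⁻¹ :=
  (one_lt_inv₀ h.fract_pos).2 (Int.fract_lt_one x)

theorem irrational_fract {x : ℝ} (h : Irrational x) : Irrational (Int.fract x) :=
  h.sub_intCast _

theorem irrational_fract_inv {x : ℝ} (h : Irrational x) : Irrational (Int.fract x)⁻¹ :=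
  irrational_inv_iff.2 (irrational_fract h)

theorem irrational_completeQuotient {x : ℝ} (h : Irrational x) (n : ℕ) :
    Irrational (completeQuotient x n) := by
  induction n with
  | zero => exact h
  | succ n ih => rw [completeQuotient_succ]; exact irrational_fract_inv ih

theorem one_lt_completeQuotient {x : ℝ} (h : Irrational x) {n : ℕ} (hn : 1 ≤ n) :
    1 < completeQuotient x n := by
  obtain ⟨m, rfl⟩ := Nat.exists_eq_add_of_le' hn
  rw [completeQuotient_succ]
  exact one_lt_fract_inv (irrational_completeQuotient h m)

/-- The orbit of `x` under the Farey map reaches `y` or `1 / y`. -/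
def Reaches (x y : ℝ) : Prop := ∃ s : ℕ, fareyMap^[s] x = y ∨ fareyMap^[s] x = y⁻¹

theorem Reaches.trans {x y z : ℝ} (hy : 0 < y) (hi : Irrational y) (h1 : Reaches x y)
    (h2 : Reaches y z) : Reaches x z := by
  obtain ⟨s, hs⟩ := h1
  obtain ⟨t, ht⟩ := h2
  refine ⟨t + s, ?_⟩
  rw [Function.iterate_add_apply]
  rcases hs with hs | hs <;> rw [hs]
  · exact ht
  · rw [fareyMap_iterate_inv hy hi]
    rcases ht with ht | ht <;> rw [ht]
    · exact Or.inr rfl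
    · exact Or.inl (inv_inv z)

theorem fareyMap_iterate_floor {x : ℝ} (hx : 0 ≤ x) : fareyMap^[⌊x⌋₊] x = Int.fract x := by
  rw [(fareyMap_iterate_of_le_floor _ (Nat.floor_le hx)).1, Int.fract, natCast_floor_eq_intCast_floor hx]

theorem reaches_fract_inv {x : ℝ} (hx : 0 ≤ x) : Reaches x (Int.fract x)⁻¹ :=
  ⟨⌊x⌋₊, Or.inr (by rw [fareyMap_iterate_floor hx, inv_inv])⟩

theorem fareyMap_of_one_lt {x : ℝ} (hx : 1 < x) : fareyMap x = x - 1 := by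
  rw [fareyMap, if_neg hx.le.not_gt]

/-- Put `θ = Int.fract x`, so that `-x` has fractional part `1 - θ`. One step from `1 / (1 - θ)`
leads to `θ / (1 - θ)`, the inverse of `1/θ - 1`, which has the same fractional part as `1/θ`. No
distinction according to the size of the next partial quotient is needed. -/
theorem reaches_neg {x : ℝ} (hx : x < 0) (hi : Irrational x) : Reaches (-x) (completeQuotient x 2) := by
  have hy1 := one_lt_fract_inv hi
  have hf := hi.fract_pos
  have e1 : Int.fract (-x) = 1 - Int.fract x := Int.fract_neg hf.ne'
  have h1 : Reaches (-x) (Int.fract (-x))⁻¹ := reaches_fract_inv (by linarith)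
  have hlt : 1 < (Int.fract (-x))⁻¹ := one_lt_fract_inv hi.neg
  have h2 : Reaches (Int.fract (-x))⁻¹ ((Int.fract x)⁻¹ - 1) := by
    refine ⟨1, Or.inr ?_⟩
    rw [Function.iterate_one, fareyMap_of_one_lt hlt, e1]
    have h3 : (1 : ℝ) - Int.fract x ≠ 0 := by linarith [Int.fract_lt_one x]
    have h4 : (Int.fract x)⁻¹ - 1 ≠ 0 := by linarith
    field_simp
    ring
  have h3 : Reaches ((Int.fract x)⁻¹ - 1) (Int.fract (Int.fract x)⁻¹)⁻¹ := by
    have := reaches_fract_inv (x := (Int.fract x)⁻¹ - 1) (by linarith)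
    rwa [Int.fract_sub_one] at this
  have hirr : Irrational ((Int.fract x)⁻¹ - 1) := by
    simpa using (irrational_fract_inv hi).sub_natCast 1
  exact Reaches.trans (by linarith) hirr
    (Reaches.trans (by linarith) (irrational_fract_inv hi.neg) h1 h2) h3

theorem reaches_abs {x : ℝ} (hi : Irrational x) {n : ℕ} (hn : 2 ≤ n) :
    Reaches |x| (completeQuotient x n) := by
  have step : ∀ m, 1 ≤ m → Reaches |x| (completeQuotient x m) →
      Reaches |x| (completeQuotient x (m + 1)) := by
    intro m hm h
    have h1 := one_lt_completeQuotient hi hm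
    refine h.trans (by linarith) (irrational_completeQuotient hi m) ?_
    rw [completeQuotient_succ]
    exact reaches_fract_inv (by linarith)
  induction n, hn using Nat.le_induction with
  | base =>
    rcases lt_or_gt_of_ne hi.ne_zero with h | h
    · rw [abs_of_neg h]; exact reaches_neg h hi
    · refine step 1 le_rfl ?_
      rw [abs_of_pos h]
      exact reaches_fract_inv h.le
  | succ m hm ih => exact step m (by omega) ih

/-- The Farey path of `[d 0; d 1, …]` starts with `T ^ d 0 V ^ d 1 T ^ d 2 ⋯`. -/
theorem fareyMatrix_eq_word : ∀ (l : List ℕ), Even l.length → ∀ {x : ℝ} {d : ℕ → ℤ},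
    HasContFract x d → (∀ i < l.length, d i = (l.getD i 0 : ℕ)) →
    fareyMatrix x l.sum = word l ∧ fareyMap^[l.sum] x = completeQuotient x l.length
  | [], _, _, _, _, _ => ⟨rfl, rfl⟩
  | [_], h, _, _, _, _ => absurd h (by simp)
  | b :: c :: l, hl, x, d, h, hd => by
    have hl' : Even l.length := by
      simpa [Nat.even_add_one] using hl
    have h1 := h.tail
    have h2 := h1.tail
    have hi1 := h1.irrational
    have hb : (⌊x⌋ : ℝ) = b := by
      rw [h.floor, hd 0 (by simp)]; simp
    have hc : (⌊(Int.fract x)⁻¹⌋ : ℝ) = c := by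
      rw [h1.floor, hd 1 (by simp)]; simp
    obtain ⟨e1, e2⟩ := fareyMap_iterate_of_le_floor b (hb ▸ Int.floor_le x)
    obtain ⟨e3, e4⟩ := fareyMap_iterate_of_le_floor c (hc ▸ Int.floor_le (Int.fract x)⁻¹)
    have hy0 : 0 < (Int.fract x)⁻¹ := inv_pos.2 h.irrational.fract_pos
    -- After `b` letters `T` the orbit is at the inverse of the next complete quotient, whose path
    -- has `T` and `V` exchanged and so begins with `c` letters `V`. A second inversion restores the
    -- roles, which is why blocks are taken in pairs.
    have e5 : fareyMap^[b] x = (Int.fract x)⁻¹⁻¹ := by rw [e1, inv_inv, Int.fract, hb]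
    have e6 : fareyMap^[c] (Int.fract x)⁻¹⁻¹ = (Int.fract (Int.fract x)⁻¹)⁻¹ := by
      rw [fareyMap_iterate_inv hy0 hi1, e3, ← hc, Int.self_sub_floor]
    obtain ⟨i1, i2⟩ := fareyMatrix_eq_word l hl' h2 (fun i hi => by
      have := hd (i + 2) (by simpa using hi)
      simpa using this)
    simp only [List.sum_cons, List.length_cons]
    constructor
    · rw [fareyMatrix_add, e2, e5, fareyMatrix_add, e6, i1, fareyMatrix_inv hy0 hi1, e4,
        swap_T_pow, ← mul_assoc]
      rfl
    · rw [← add_assoc, add_comm (b + c), Function.iterate_add_apply, add_comm b c,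
        Function.iterate_add_apply, e5, e6, i2, completeQuotient_succ', completeQuotient_succ']

/-! ### Positivity of the entries of the period word -/

theorem isFareyMatrix_pow {M : SL(2, ℤ)} (h : IsFareyMatrix M) (n : ℕ) : IsFareyMatrix (M ^ n) := by
  induction n with
  | zero => simpa using IsFareyMatrix.one
  | succ n ih => rw [pow_succ]; exact ih.mul h

theorem isFareyMatrix_word : ∀ l : List ℕ, IsFareyMatrix (word l)
  | [] => .one
  | [b] => isFareyMatrix_pow .T b
  | b :: c :: l =>
    ((isFareyMatrix_pow .T b).mul (isFareyMatrix_pow .V c)).mul (isFareyMatrix_word l)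

theorem word_off_diag_pos {b c : ℕ} (hb : 0 < b) (hc : 0 < c) (l : List ℕ) :
    0 < word (b :: c :: l) 0 1 ∧ 0 < word (b :: c :: l) 1 0 := by
  have hT := isFareyMatrix_pow .T b
  have hV := isFareyMatrix_pow .V c
  have h1 : 0 < (ModularGroup.T ^ b) 0 1 := by
    obtain ⟨n, rfl⟩ := Nat.exists_eq_add_of_le' hb
    have := isFareyMatrix_pow .T n
    rw [pow_succ, (mul_T _).2.1]
    linarith [this.p, this.q]
  have h2 : 0 < (V ^ c) 1 0 := by
    obtain ⟨n, rfl⟩ := Nat.exists_eq_add_of_le' hc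
    have := isFareyMatrix_pow .V n
    rw [pow_succ, (mul_V _).2.2.1]
    linarith [this.r, this.s]
  refine (hT.mul hV).off_diag_mul_right (isFareyMatrix_word l) ?_
  rw [mul_apply_two, mul_apply_two]
  constructor
  · have := mul_pos h1 (zero_lt_one.trans_le hV.s)
    have := mul_nonneg (zero_le_one.trans hT.p) hV.q
    linarith
  · have := mul_nonneg hT.r (zero_le_one.trans hV.p)
    have := mul_pos (zero_lt_one.trans_le hT.s) h2
    linarith

end ModularLyapunov

end

/-! ### The Lyapunov exponent at an eventually periodic continued fraction -/

theorem theorem1p2 (f : ℍ → ℂ)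
    (hf : ModularLyapunov.IsWeaklyHolomorphicModularFunction f) (hf0 : f ≠ 0)
    (hpos : ModularLyapunov.IsNonnegOnArc f)
    (x : ℝ) (a : List ℤ) (b : List ℕ) (hb : 2 ≤ b.length) (hb_even : Even b.length)
    (hx : ModularLyapunov.HasContFract x (ModularLyapunov.eventuallyPeriodic a b)) :
    ModularLyapunov.lyapunov f x =
        (((ModularLyapunov.cycleIntegral f (ModularLyapunov.word b)).re / (b.sum : ℝ) : ℝ) : EReal) ∧
      0 < ModularLyapunov.lyapunov f x := by
  open ModularLyapunov in
  have hi := hx.irrational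
  -- One period beyond the preperiod: then `k ≥ 2` even if `a` is empty, so that `z > 1` and
  -- `reaches_abs` applies.
  set k := a.length + b.length with hk
  set z := completeQuotient x k with hz
  have hk2 : 2 ≤ k := by omega
  have hz1 : 1 < z := one_lt_completeQuotient hi (by omega)
  have hz0 : 0 < z := by linarith
  have hzi : Irrational z := irrational_completeQuotient hi k
  have hzd : HasContFract z (fun i => ((b.getD (i % b.length) 0 : ℕ) : ℤ)) := by
    have h := hx.completeQuotient k
    have e : (fun i => eventuallyPeriodic a b (i + k))
        = fun i => ((b.getD (i % b.length) 0 : ℕ) : ℤ) := by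
      funext i
      rw [eventuallyPeriodic, if_neg (by omega),
        show i + k - a.length = i + b.length by omega, Nat.add_mod_right]
    rwa [e] at h
  obtain ⟨hword, hmap⟩ := fareyMatrix_eq_word b hb_even hzd
    (fun i hi => by rw [Nat.mod_eq_of_lt hi])
  have hper : fareyMap^[b.sum] z = z := by
    rw [hmap]
    have h := hzd.completeQuotient b.length
    simp only [Nat.add_mod_right] at h
    exact h.unique hzd
  -- Each `b_i` is the floor of a complete quotient of `z`, and these all exceed `1`; for index `0`
  -- this needs `z > 1`.
  have hbpos : ∀ i < b.length, 0 < b.getD i 0 := by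
    intro i hi'
    have h := (hzd.completeQuotient i).floor
    simp only [zero_add, Nat.mod_eq_of_lt hi'] at h
    have h1 : 1 < completeQuotient z i := by
      rcases Nat.eq_zero_or_pos i with rfl | h0
      · exact hz1
      · exact one_lt_completeQuotient hzi h0
    have h2 : (1 : ℤ) ≤ ⌊completeQuotient z i⌋ := Int.le_floor.2 (by exact_mod_cast h1.le)
    omega
  have hsum0 : 0 < b.sum := by
    have h := hbpos 0 (by omega)
    match b, h with
    | c :: l, h => simp at h ⊢; omega
  have hoff : 0 < fareyMatrix z b.sum 0 1 ∧ 0 < fareyMatrix z b.sum 1 0 := by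
    rw [hword]
    have h0 := hbpos 0 (by omega)
    have h1 := hbpos 1 (by omega)
    match b, hb, h0, h1 with
    | b₁ :: b₂ :: l, _, h0, h1 => exact word_off_diag_pos (by simpa using h0) (by simpa using h1) l
  have hia : Irrational |x| := by
    rcases abs_choice x with h | h <;> rw [h]
    exacts [hi, hi.neg]
  have hlim : Filter.Tendsto (fun n : ℕ => (cycleIntegral f (fareyMatrix |x| n)).re / (n : ℝ))
      Filter.atTop (𝓝 ((cycleIntegral f (word b)).re / (b.sum : ℝ))) := by
    obtain ⟨s, hs | hs⟩ := reaches_abs hi hk2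
    · have h := tendsto_re_cycleIntegral_div hf hpos (abs_pos.2 hi.ne_zero) hia
        (s := s) hsum0 (by rw [hs]; exact hper) (by rw [hs]; exact hoff)
      rwa [hs, hword] at h
    -- Here the orbit of `|x|` enters the inverted cycle, whose period word has `T` and `V`
    -- exchanged but the same real part of the cycle integral.
    · have h := tendsto_re_cycleIntegral_div hf hpos (abs_pos.2 hi.ne_zero) hia
        (s := s) hsum0 (by rw [hs, fareyMap_iterate_inv hz0 hzi, hper])
        (by rw [hs, fareyMatrix_inv hz0 hzi]; exact ⟨hoff.2, hoff.1⟩)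
      rwa [hs, re_cycleIntegral_inv hf hpos hz0 hzi hoff, hword] at h
  have hlyap : lyapunov f x = (((cycleIntegral f (word b)).re / (b.sum : ℝ) : ℝ) : EReal) :=
    ((continuous_coe_real_ereal.tendsto _).comp hlim).limsup_eq
  refine ⟨hlyap, ?_⟩
  rw [hlyap, EReal.coe_pos, ← hword]
  exact div_pos (re_cycleIntegral_period_pos hf hf0 hpos hz0 hzi hsum0 hper hoff)
    (by exact_mod_cast hsum0)
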